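/- Consider $L$ sensors that share one time-slotted channel. In every slot, sensor $i$ takes a sample with probability $r_i>0$, independently of everything else. The measurement of sensor $i$ in slot $t$ has distribution $f_{0,i}$ if $t\le\nu$ and $f_{1,i}$ if $t>\nu$, where $\nu$ is the change point; measurements are independent across sensors and slots, and $f_{1,i}\ll f_{0,i}$, so that the log-likelihood ratios below are well defined. Each sensor keeps its samples in an infinite queue; a sample taken in slot $t$ can be sent from slot $t+1$ on. In each slot in which some queue is nonempty, a sensor is chosen uniformly at random among those with a nonempty queue and transmits one of its waiting samples, picked by an arbitrary fixed deterministic rule depending on the set of its waiting samples (e.g. first-come-first-served or last-come-first-served). The transmission succeeds with probability $p$, the same before and after the change, independently of everything else. A received sample leaves the queue and a failed one remains. Assume $\sum_i r_i<p\le 1$. For each slot let $Y\in\{1,0,\emptyset\}$ indicate a successful, a failed, or no transmission; if $Y=1$, let $U$ be the sensor, $J$ the sampling slot and $Z$ the value of the received measurement (unobserved otherwise). Let $\mathbb P_\nu$ be the law with change point $\nu$ (so under $\mathbb P_0$ all samples taken from slot $1$ on are post-change, and under $\mathbb P_\infty$ all samples are pre-change), given the vector $\boldsymbol Q_1$ of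 queue lengths at the beginning of slot $1$; the packets waiting then were sampled in slots $\le 0$, and the conditional law of their sampling slots is arbitrary and the same under all $\mathbb P_\nu$. Let $$l_{0,n}=\log\frac{d\mathbb P_0(U_1^n,Y_1^n,J_1^n,Z_1^n\mid \boldsymbol Q_1)}{d\mathbb P_\infty(U_1^n,Y_1^n,J_1^n,Z_1^n\mid \boldsymbol Q_1)}$$ be the log-likelihood ratio of the observations in slots $1,\dots,n$. Then: 1. The Markov chain of queue-length vectors has exactly one stationary distribution, and in steady state $$\mathbb P(Y=1)=\sum_{i=1}^L r_i,\qquad \mathbb P(U=i\mid Y=1)=\frac{r_i}{\sum_{j=1}^L r_j}\quad(1\le i\le L).$$ 2. For every value of $\boldsymbol Q_1$ the law of the observations in slots $1,\dots,n$ under $\mathbb P_0$ is absolutely continuous with respect to that under $\mathbb P_\infty$, for every $n$, and $\mathbb P_0$-almost surely the information rate $\bar I=\lim_{n\to\infty}\frac1n\,l_{0,n}$ exists and $$\bar I=\sum_{i=1}^L r_i\,D(f_{1,i}\,\|\,f_{0,i}),$$ where $D$ is the Kullback–Leibler divergence (if some $D(f_{1,i}\|f_{0,i})=\infty$, both sides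 are $+\infty$). -/

import Mathlib

open MeasureTheory ProbabilityTheory InformationTheory Filter Topology
open scoped ENNReal

/-- `L` sensors sharing one channel: sampling probabilities, packet success probability, pre- and
post-change distributions of each sensor, and the rule by which a sensor that has been granted the
channel picks one of its waiting samples. A waiting sample is named by the slot in which it was
taken; `discipline i s` is the sample picked by sensor `i` from the set `s` of waiting ones
(the minimum for FCFS, the maximum for LCFS). -/
structure SensorNetwork (L : ℕ) (E : Type*) [MeasurableSpace E] where
  rate : Fin L → unitInterval
  success : unitInterval
  pre : Fin L → ProbabilityMeasure E
  post : Fin L → ProbabilityMeasure E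
  discipline : Fin L → Finset ℤ → ℤ
  discipline_mem : ∀ i s, s.Nonempty → discipline i s ∈ s

namespace SensorNetwork

instance : MeasurableSpace (Finset ℤ) := ⊤

/-- For every nonempty set of sensors, a choice of one of its members. -/
abbrev Pick (L : ℕ) : Type := (S : {S : Finset (Fin L) // S.Nonempty}) → S.1

/-- The randomness of one slot: which sensors take a sample, whether the channel would deliver a
packet, and which sensor would be granted the channel out of each set of contending sensors. -/
abbrev SlotNoise (L : ℕ) : Type := (Fin L → Bool) × Bool × Pick L

/-- What the decision maker observes in one slot: no transmission, a failed transmission, or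
the sensor `U`, the sampling slot `J` and the measurement `Z` of a received packet. -/
abbrev SlotObs (L : ℕ) (E : Type*) : Type _ := Unit ⊕ Unit ⊕ (Fin L × ℤ × E)

/-- Sample space: the queue contents at the beginning of slot `1`, the randomness of the slots
(entry `k` belongs to slot `k + 1`), and the measurement `X t i` of each sensor `i` in each
slot `t`. -/
abbrev Outcome (L : ℕ) (E : Type*) : Type _ :=
  (Fin L → Finset ℤ) × (ℕ → SlotNoise L) × (ℤ × Fin L → E)

/-- The sensor that transmits, given the queue lengths: one of those with a nonempty queue. -/
def transmitter {L : ℕ} (w : SlotNoise L) (q : Fin L → ℕ) : Option (Fin L) :=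
  if h : (Finset.univ.filter fun i => q i ≠ 0).Nonempty then some (w.2.2 ⟨_, h⟩).1 else none

/-- The sensor whose packet is received: `some i` encodes `Y = 1, U = i`. -/
def delivered {L : ℕ} (w : SlotNoise L) (q : Fin L → ℕ) : Option (Fin L) :=
  if w.2.1 then transmitter w q else none

/-- Evolution of the queue lengths over one slot. -/
def lengthStep {L : ℕ} (w : SlotNoise L) (q : Fin L → ℕ) : Fin L → ℕ := fun i =>
  (q i - if delivered w q = some i then 1 else 0) + if w.1 i then 1 else 0

/-- Sampling, channel and scheduling are independent; the transmitting sensor is uniform on the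
set of sensors with a nonempty queue. -/
noncomputable def slotLaw {L : ℕ} {E : Type*} [MeasurableSpace E] (N : SensorNetwork L E) :
    Measure (SlotNoise L) :=
  (Measure.pi fun i => bernoulliMeasure true false (N.rate i)).prod
    ((bernoulliMeasure true false N.success).prod
      (Measure.pi fun S : {S : Finset (Fin L) // S.Nonempty} =>
        uniformOn (Set.univ : Set S.1)))

instance {L : ℕ} {E : Type*} [MeasurableSpace E] (N : SensorNetwork L E) :
    IsProbabilityMeasure N.slotLaw := by
  have h : ∀ S : {S : Finset (Fin L) // S.Nonempty},
      IsProbabilityMeasure (uniformOn (Set.univ : Set S.1)) := fun S =>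
    isProbabilityMeasure_uniformOn Set.finite_univ
      (@Set.univ_nonempty _ S.2.to_subtype)
  unfold slotLaw
  infer_instance

section Dynamics

variable {L : ℕ} {E : Type*} [MeasurableSpace E] (N : SensorNetwork L E)

/-- Evolution of the queue contents over slot `t`: the received packet leaves, and the samples
taken in slot `t` enter, to be available from slot `t + 1` on. -/
def queueStep (w : SlotNoise L) (t : ℤ) (s : Fin L → Finset ℤ) : Fin L → Finset ℤ := fun i =>
  (if delivered w (fun j => (s j).card) = some i then (s i).erase (N.discipline i (s i)) else s i)
    ∪ (if w.1 i then {t} else ∅)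

/-- The queue contents at the beginning of slot `k + 1`. -/
def queueAt (ω : Outcome L E) : ℕ → Fin L → Finset ℤ
  | 0 => ω.1
  | k + 1 => N.queueStep (ω.2.1 k) ((k : ℤ) + 1) (queueAt ω k)

/-- The observation `(U, Y, J, Z)` in a slot with randomness `w` and initial queue contents `s`,
when the measurements are `X`. -/
def slotObs (w : SlotNoise L) (s : Fin L → Finset ℤ) (X : ℤ × Fin L → E) : SlotObs L E :=
  match transmitter w (fun j => (s j).card) with
  | none => Sum.inl ()
  | some i =>
    if w.2.1 then Sum.inr (Sum.inr (i, N.discipline i (s i), X (N.discipline i (s i), i)))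
    else Sum.inr (Sum.inl ())

/-- The observation of the decision maker in slot `k + 1`. -/
def obsAt (ω : Outcome L E) (k : ℕ) : SlotObs L E :=
  N.slotObs (ω.2.1 k) (N.queueAt ω k) ω.2.2

/-- The observations in the slots `1, …, n`. -/
def obs (n : ℕ) (ω : Outcome L E) : Fin n → SlotObs L E := fun k => N.obsAt ω k

/-- Law of the measurement of sensor `x.2` in slot `x.1` when the change happens at the end of
slot `ν`. -/
noncomputable def sampleLaw (ν : WithTop ℤ) (x : ℤ × Fin L) : Measure E :=
  if (x.1 : WithTop ℤ) ≤ ν then (N.pre x.2 : Measure E) else (N.post x.2 : Measure E)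

instance (ν : WithTop ℤ) (x : ℤ × Fin L) : IsProbabilityMeasure (N.sampleLaw ν x) := by
  unfold sampleLaw
  split_ifs <;> infer_instance

/-- The law `P_ν` on the sample space, when the initial queue contents have law `init`. -/
noncomputable def law (init : PMF (Fin L → Finset ℤ)) (ν : WithTop ℤ) : Measure (Outcome L E) :=
  init.toMeasure.prod
    ((Measure.infinitePi fun _ : ℕ => N.slotLaw).prod (Measure.infinitePi (N.sampleLaw ν)))

/-- The law under `P_ν` of the observations in the slots `1, …, n`. -/
noncomputable def obsLaw (init : PMF (Fin L → Finset ℤ)) (ν : WithTop ℤ) (n : ℕ) :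
    Measure (Fin n → SlotObs L E) :=
  (N.law init ν).map (N.obs n)

/-- The log-likelihood ratio of `P_ν` against `P_∞` for the observations in the slots
`1, …, n`. -/
noncomputable def logLR (init : PMF (Fin L → Finset ℤ)) (ν : WithTop ℤ) (n : ℕ)
    (ω : Outcome L E) : ℝ :=
  llr (N.obsLaw init ν n) (N.obsLaw init ⊤ n) (N.obs n ω)

/-- Stationary distributions of the Markov chain of queue-length vectors. -/
def IsStationary (π : Measure (Fin L → ℕ)) : Prop :=
  IsProbabilityMeasure π ∧
    (π.prod N.slotLaw).map (fun x => lengthStep x.2 x.1) = π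

/-- The event `Y = 1`, on pairs of queue lengths at the beginning of a slot and randomness of
that slot. -/
def received (L : ℕ) : Set ((Fin L → ℕ) × SlotNoise L) := {x | (delivered x.2 x.1).isSome}

/-- The event `Y = 1, U = i`. -/
def receivedFrom {L : ℕ} (i : Fin L) : Set ((Fin L → ℕ) × SlotNoise L) :=
  {x | delivered x.2 x.1 = some i}

end Dynamics

end SensorNetwork

/-!
Off the empty state the expected total queue length drops by at least `p - ∑ r` per slot, so by
Foster's criterion an excursion from the empty state has finite mean length; its occupation measure,
normalised, is the only invariant probability law. In steady state arrivals and departures of each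
sensor balance on average, even if the queue lengths are not integrable, because only their
increments have to be; this gives the departure probabilities.

For the information rate, only received measurements carry information and each packet is received
at most once, so `l_{0,n}` is the sum of the log-likelihood ratios of the packets received up to
slot `n`, where packets sampled before the change contribute `0`. All queues grow sublinearly,
hence post-change packets of sensor `i` are received at the rate `r_i` at which they are sampled.
Given the schedule of transmissions, which does not depend on the measurements, the values of these
packets are independent with law `f_{1,i}`, and the strong law of large numbers applies; it covers
an infinite divergence because the negative part of the log-likelihood ratio is integrable.
-/

section Recurrence

variable {α : Type*} {mα : MeasurableSpace α}

/-- The law at time `k` of a chain with transition kernel `κ` started at `a`, on the event that it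
has not returned to `a` at the times `1, …, k`. -/
noncomputable def excursionLaw (κ : Kernel α α) (a : α) : ℕ → Measure α
  | 0 => Measure.dirac a
  | k + 1 => (κ ∘ₘ excursionLaw κ a k).restrict {a}ᶜ

/-- The expected time a chain with transition kernel `κ` spends in a set between a visit to `a`
and the next one. -/
noncomputable def excursionOccupation (κ : Kernel α α) (a : α) : Measure α :=
  Measure.sum (excursionLaw κ a)

variable {κ : Kernel α α} {a : α} {V : α → NNReal} {ε : ℝ≥0∞}

lemma comp_mono_right {μ ν : Measure α} (h : μ ≤ ν) : κ ∘ₘ μ ≤ κ ∘ₘ ν :=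
  Measure.le_iff.2 fun s hs => by
    rw [Measure.bind_apply hs (Kernel.aemeasurable _),
      Measure.bind_apply hs (Kernel.aemeasurable _)]
    exact lintegral_mono' h le_rfl

lemma lintegral_min_add_indicator_le [IsMarkovKernel κ] {x : α}
    (hdrift : ∫⁻ y, V y ∂κ x + ε ≤ V x) (M : NNReal) :
    ∫⁻ y, (min (V y) M : NNReal) ∂κ x + {x | V x ≤ M}.indicator (fun _ => ε) x ≤
      (min (V x) M : NNReal) := by
  by_cases hx : V x ≤ M
  · rw [Set.indicator_of_mem (s := {x | V x ≤ M}) hx, min_eq_left hx]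
    exact (add_le_add_left (lintegral_mono fun y =>
      ENNReal.coe_le_coe.2 (min_le_left (V y) M)) _).trans hdrift
  · rw [Set.indicator_of_notMem (s := {x | V x ≤ M}) hx, min_eq_right (not_le.1 hx).le,
      add_zero]
    calc ∫⁻ y, (min (V y) M : NNReal) ∂κ x ≤ ∫⁻ _, M ∂κ x :=
          lintegral_mono fun y => ENNReal.coe_le_coe.2 (min_le_right (V y) M)
      _ = M := by simp

lemma eq_zero_of_invariant_of_drift [IsMarkovKernel κ] (hV : Measurable V) (hε : ε ≠ 0)
    (hdrift : ∀ x, x ≠ a → ∫⁻ y, V y ∂κ x + ε ≤ V x) {m : Measure α} [IsFiniteMeasure m]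
    (hm : κ.Invariant m) (hma : m {a} = 0) : m = 0 := by
  have hne : ∀ᵐ x ∂m, x ≠ a := measure_eq_zero_iff_ae_notMem.1 hma
  have hlevel : ∀ M : NNReal, m {x | V x ≤ M} = 0 := fun M => by
    have hmeas : MeasurableSet {x | V x ≤ M} := measurableSet_le hV measurable_const
    have hfin : ∫⁻ x, (min (V x) M : NNReal) ∂m ≠ ∞ :=
      (IsFiniteMeasure.lintegral_lt_top_of_bounded_to_ennreal m
        ⟨M, fun x => ENNReal.coe_le_coe.2 (min_le_right _ _)⟩).ne
    have hle : ∫⁻ x, (min (V x) M : NNReal) ∂m + ε * m {x | V x ≤ M} ≤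
        ∫⁻ x, (min (V x) M : NNReal) ∂m := by
      conv_lhs => rw [← hm.def]
      rw [Measure.lintegral_bind (Kernel.aemeasurable _) (by fun_prop), hm.def,
        ← lintegral_indicator_const hmeas, ← lintegral_add_right _ (by fun_prop)]
      exact lintegral_mono_ae (hne.mono fun x hx => lintegral_min_add_indicator_le (hdrift x hx) M)
    have hzero : ε * m {x | V x ≤ M} = 0 := by
      simpa using (ENNReal.add_le_add_iff_left hfin).1 (hle.trans (add_zero _).ge)
    exact (mul_eq_zero.1 hzero).resolve_left hε
  have hcover : ⋃ n : ℕ, {x | V x ≤ n} = Set.univ :=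
    Set.iUnion_eq_univ_iff.2 fun x => exists_nat_ge (V x)
  rw [← Measure.measure_univ_eq_zero, ← hcover]
  exact measure_iUnion_null fun n : ℕ => hlevel n

variable [MeasurableSingletonClass α]

variable (κ a) in
lemma excursionOccupation_eq :
    excursionOccupation κ a =
      Measure.dirac a + (κ ∘ₘ excursionOccupation κ a).restrict {a}ᶜ := by
  have hcomp : κ ∘ₘ excursionOccupation κ a = Measure.sum fun k => κ ∘ₘ excursionLaw κ a k :=
    Measure.bind_sum _ _ (Kernel.aemeasurable _)
  rw [hcomp, Measure.restrict_sum _ (measurableSet_singleton a).compl]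
  ext s hs
  rw [excursionOccupation, Measure.sum_apply _ hs, tsum_eq_zero_add' ENNReal.summable,
    Measure.add_apply, Measure.sum_apply _ hs]
  rfl

variable (κ a) in
lemma excursionOccupation_singleton : excursionOccupation κ a {a} = 1 := by
  rw [excursionOccupation_eq, Measure.add_apply,
    Measure.restrict_apply (measurableSet_singleton a)]
  simp

lemma invariant_excursionOccupation [IsMarkovKernel κ]
    [IsFiniteMeasure (excursionOccupation κ a)] :
    κ.Invariant (excursionOccupation κ a) := by
  set m := excursionOccupation κ a
  have hdecomp : m = Measure.dirac a + (κ ∘ₘ m).restrict {a}ᶜ := excursionOccupation_eq κ a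
  have hreturn : (κ ∘ₘ m) {a} = 1 := by
    have hmass := congrArg (· Set.univ) hdecomp
    simp only [Measure.add_apply, measure_univ, Measure.restrict_apply_univ] at hmass
    rw [← Measure.comp_apply_univ (κ := κ) (μ := m),
      ← measure_add_measure_compl (measurableSet_singleton a)] at hmass
    exact (ENNReal.add_left_inj (measure_ne_top _ _)).1 hmass
  have hsplit := Measure.restrict_add_restrict_compl (μ := κ ∘ₘ m) (measurableSet_singleton a)
  rw [Measure.restrict_singleton, hreturn, one_smul, ← hdecomp] at hsplit
  exact hsplit.symm

/-- Iterating `π = (κ ∘ₘ π).restrict {a}ᶜ + π {a} • dirac a` from `0` produces the partial sums of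
the occupation measure. -/
lemma smul_excursionOccupation_le {π : Measure α} (hπ : κ.Invariant π) :
    π {a} • excursionOccupation κ a ≤ π := by
  set S : ℕ → Measure α := fun n => ∑ k ∈ Finset.range n, excursionLaw κ a k with hS
  have hrestrict : ∀ n, (κ ∘ₘ S n).restrict {a}ᶜ =
      ∑ k ∈ Finset.range n, excursionLaw κ a (k + 1) := fun n => by
    induction n with
    | zero => simp [hS]
    | succ n ih =>
      simp only [hS, Finset.sum_range_succ] at ih ⊢
      rw [Measure.comp_add, Measure.restrict_add, ih]
      rfl
  have hsucc : ∀ n, S (n + 1) = (κ ∘ₘ S n).restrict {a}ᶜ + Measure.dirac a := fun n => by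
    rw [hrestrict, hS]
    exact Finset.sum_range_succ' _ _
  have hdecomp : π = (κ ∘ₘ π).restrict {a}ᶜ + π {a} • Measure.dirac a := by
    rw [hπ.def, ← Measure.restrict_singleton,
      Measure.restrict_compl_add_restrict (measurableSet_singleton a)]
  have hle : ∀ n, π {a} • S n ≤ π := fun n => by
    induction n with
    | zero => simpa [hS] using Measure.zero_le π
    | succ n ih =>
      calc π {a} • S (n + 1)
          = (κ ∘ₘ (π {a} • S n)).restrict {a}ᶜ + π {a} • Measure.dirac a := by
            rw [hsucc, smul_add, Measure.comp_smul, Measure.restrict_smul]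
        _ ≤ (κ ∘ₘ π).restrict {a}ᶜ + π {a} • Measure.dirac a :=
            add_le_add_left (Measure.restrict_mono le_rfl (comp_mono_right ih)) _
        _ = π := hdecomp.symm
  refine Measure.le_iff.2 fun s hs => ?_
  rw [Measure.smul_apply, excursionOccupation, Measure.sum_apply _ hs, smul_eq_mul,
    ENNReal.tsum_eq_iSup_nat, ENNReal.mul_iSup]
  exact iSup_le fun n => by simpa [hS] using hle n s

lemma lintegral_excursionLaw_succ_add_le (hV : Measurable V)
    (hdrift : ∀ x, x ≠ a → ∫⁻ y, V y ∂κ x + ε ≤ V x) (k : ℕ) :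
    ∫⁻ x, V x ∂excursionLaw κ a (k + 2) + ε * excursionLaw κ a (k + 1) Set.univ ≤
      ∫⁻ x, V x ∂excursionLaw κ a (k + 1) := by
  have hne : ∀ᵐ x ∂excursionLaw κ a (k + 1), x ≠ a :=
    ae_restrict_mem (measurableSet_singleton a).compl
  calc ∫⁻ x, V x ∂excursionLaw κ a (k + 2) + ε * excursionLaw κ a (k + 1) Set.univ
      ≤ ∫⁻ x, V x ∂(κ ∘ₘ excursionLaw κ a (k + 1)) +
          ε * excursionLaw κ a (k + 1) Set.univ :=
        add_le_add_left (lintegral_mono' Measure.restrict_le_self le_rfl) _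
    _ = ∫⁻ x, (∫⁻ y, V y ∂κ x + ε) ∂excursionLaw κ a (k + 1) := by
        rw [Measure.lintegral_bind (Kernel.aemeasurable _) (by fun_prop),
          lintegral_add_right _ measurable_const, lintegral_const]
    _ ≤ ∫⁻ x, V x ∂excursionLaw κ a (k + 1) :=
        lintegral_mono_ae (hne.mono fun x hx => hdrift x hx)

lemma isFiniteMeasure_excursionOccupation_of_drift (hV : Measurable V) (hε : ε ≠ 0)
    (ha : ∫⁻ y, V y ∂κ a ≠ ∞) (hdrift : ∀ x, x ≠ a → ∫⁻ y, V y ∂κ x + ε ≤ V x) :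
    IsFiniteMeasure (excursionOccupation κ a) := by
  set W : ℕ → ℝ≥0∞ := fun k => ∫⁻ x, V x ∂excursionLaw κ a k
  have htelescope : ∀ n,
      W (n + 1) + ∑ k ∈ Finset.range n, ε * excursionLaw κ a (k + 1) Set.univ ≤ W 1 := fun n => by
    induction n with
    | zero => simp
    | succ n ih =>
      refine le_trans ?_ ih
      rw [Finset.sum_range_succ, add_comm (Finset.sum _ _), ← add_assoc]
      exact add_le_add_left (lintegral_excursionLaw_succ_add_le hV hdrift n) _
  have hW1 : W 1 ≠ ∞ := by
    refine ne_top_of_le_ne_top ha ?_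
    calc W 1 ≤ ∫⁻ x, V x ∂(κ ∘ₘ Measure.dirac a) := lintegral_mono' Measure.restrict_le_self le_rfl
      _ = ∫⁻ x, V x ∂κ a := by rw [Measure.dirac_bind κ.measurable]
  have hsum : ε * ∑' k, excursionLaw κ a (k + 1) Set.univ ≤ W 1 := by
    rw [← ENNReal.tsum_mul_left, ENNReal.tsum_eq_iSup_nat]
    exact iSup_le fun n => le_add_self.trans (htelescope n)
  have hfin : ∑' k, excursionLaw κ a (k + 1) Set.univ ≠ ∞ := fun h => by
    rw [h, ENNReal.mul_top hε] at hsum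
    exact hW1 (top_le_iff.1 hsum)
  refine ⟨?_⟩
  rw [excursionOccupation, Measure.sum_apply _ .univ, tsum_eq_zero_add' ENNReal.summable]
  exact ENNReal.add_lt_top.2 ⟨by simp [excursionLaw], hfin.lt_top⟩

variable [IsMarkovKernel κ]

lemma eq_smul_excursionOccupation_of_drift (hV : Measurable V) (hε : ε ≠ 0)
    (ha : ∫⁻ y, V y ∂κ a ≠ ∞) (hdrift : ∀ x, x ≠ a → ∫⁻ y, V y ∂κ x + ε ≤ V x)
    {π : Measure α} [IsFiniteMeasure π] (hπ : κ.Invariant π) :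
    π = π {a} • excursionOccupation κ a := by
  have := isFiniteMeasure_excursionOccupation_of_drift hV hε ha hdrift
  set m := π {a} • excursionOccupation κ a with hm
  have : IsFiniteMeasure m := Measure.smul_finite _ (measure_ne_top _ _)
  have hsub : π - m + m = π := Measure.sub_add_cancel_of_le (smul_excursionOccupation_le hπ)
  have hminv : κ ∘ₘ m = m := by rw [hm, Measure.comp_smul, invariant_excursionOccupation.def]
  have hinv : κ.Invariant (π - m) := by
    have hadd : κ ∘ₘ (π - m) + m = π - m + m := by
      calc κ ∘ₘ (π - m) + m = κ ∘ₘ (π - m) + κ ∘ₘ m := by rw [hminv]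
        _ = κ ∘ₘ π := by rw [← Measure.comp_add, hsub]
        _ = π - m + m := by rw [hπ.def, hsub]
    ext s
    exact (ENNReal.add_left_inj (measure_ne_top m s)).1 (congrArg (· s) hadd)
  have hatom : (π - m) {a} = 0 := by
    rw [Measure.sub_apply (measurableSet_singleton a) (smul_excursionOccupation_le hπ),
      Measure.smul_apply, excursionOccupation_singleton]
    simp
  rw [eq_zero_of_invariant_of_drift hV hε hdrift hinv hatom, zero_add] at hsub
  exact hsub.symm

/-- Foster's criterion. -/
theorem existsUnique_invariant_of_drift (hV : Measurable V) (hε : ε ≠ 0)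
    (ha : ∫⁻ y, V y ∂κ a ≠ ∞) (hdrift : ∀ x, x ≠ a → ∫⁻ y, V y ∂κ x + ε ≤ V x) :
    ∃! π : Measure α, IsProbabilityMeasure π ∧ κ.Invariant π := by
  have hfin := isFiniteMeasure_excursionOccupation_of_drift hV hε ha hdrift
  set m := excursionOccupation κ a with hm
  have hne : m ≠ 0 := fun h => by
    simpa [← hm, h] using excursionOccupation_singleton κ a
  have : NeZero m := ⟨hne⟩
  refine ⟨(m Set.univ)⁻¹ • m, ⟨inferInstance, ?_⟩, fun π ⟨hprob, hπ⟩ => ?_⟩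
  · rw [Kernel.Invariant, Measure.comp_smul, invariant_excursionOccupation.def]
  · have heq := eq_smul_excursionOccupation_of_drift hV hε ha hdrift hπ
    have hmass := congrArg (· Set.univ) heq
    simp only [measure_univ, Measure.smul_apply, smul_eq_mul] at hmass
    rw [← ENNReal.eq_inv_of_mul_eq_one_left hmass.symm]
    exact heq

end Recurrence

lemma integral_sub_eq_zero_of_identDistrib {Ω : Type*} {mΩ : MeasurableSpace Ω} {μ : Measure Ω}
    [IsFiniteMeasure μ] {f g : Ω → ℝ} (h : IdentDistrib f g μ μ)
    (hint : Integrable (fun ω => f ω - g ω) μ) : ∫ ω, (f ω - g ω) ∂μ = 0 := by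
  set clamp : ℕ → ℝ → ℝ := fun M x => max (-M) (min x M)
  have hlip : ∀ M, LipschitzWith 1 (clamp M) := fun M => (LipschitzWith.id.min_const _).const_max _
  have hident : ∀ M, IdentDistrib (fun ω => clamp M (f ω)) (fun ω => clamp M (g ω)) μ μ :=
    fun M => h.comp (hlip M).continuous.measurable
  have hbound : ∀ (M : ℕ) x, ‖clamp M x‖ ≤ M := fun M x =>
    abs_le.2 ⟨le_max_left _ _, max_le (by linarith [M.cast_nonneg (α := ℝ)]) (min_le_right _ _)⟩
  have hzero : ∀ M, ∫ ω, (clamp M (f ω) - clamp M (g ω)) ∂μ = 0 := fun M => by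
    have hintegrable : ∀ {h : Ω → ℝ}, AEMeasurable (fun ω => clamp M (h ω)) μ →
        Integrable (fun ω => clamp M (h ω)) μ := fun hm =>
      .of_bound hm.aestronglyMeasurable M (ae_of_all _ fun _ => hbound ..)
    rw [integral_sub (hintegrable (hident M).aemeasurable_fst)
      (hintegrable (hident M).aemeasurable_snd), (hident M).integral_eq, sub_self]
  have heventually : ∀ x, ∀ᶠ M : ℕ in atTop, clamp M x = x := fun x => by
    obtain ⟨m, hm⟩ := exists_nat_ge |x|
    filter_upwards [eventually_ge_atTop m] with M hM
    have hxM : |x| ≤ M := hm.trans (by exact_mod_cast hM)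
    rw [abs_le] at hxM
    simp only [clamp, min_eq_left hxM.2, max_eq_right hxM.1]
  have hlim : Tendsto (fun M => ∫ ω, (clamp M (f ω) - clamp M (g ω)) ∂μ) atTop
      (𝓝 (∫ ω, (f ω - g ω) ∂μ)) := by
    refine tendsto_integral_of_dominated_convergence (fun ω => |f ω - g ω|)
      (fun M => ((hident M).aemeasurable_fst.sub (hident M).aemeasurable_snd).aestronglyMeasurable)
      hint.abs (fun M => ae_of_all _ fun ω => ?_) (ae_of_all _ fun ω => ?_)
    · simpa [Real.dist_eq] using (hlip M).dist_le_mul (f ω) (g ω)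
    · refine tendsto_const_nhds.congr' ?_
      filter_upwards [heventually (f ω), heventually (g ω)] with M hf hg
      rw [hf, hg]
  simp only [hzero] at hlim
  exact tendsto_nhds_unique hlim tendsto_const_nhds

namespace SensorNetwork

section QueueLengths

variable {L : ℕ} {w : SlotNoise L} {q : Fin L → ℕ}

lemma ne_zero_of_transmitter_eq_some {i : Fin L} (h : transmitter w q = some i) : q i ≠ 0 := by
  unfold transmitter at h
  split_ifs at h with hne
  obtain rfl := Option.some.inj h
  exact (Finset.mem_filter.1 (w.2.2 ⟨_, hne⟩).2).2

lemma exists_transmitter_eq_some (w : SlotNoise L) (hq : q ≠ 0) :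
    ∃ i, transmitter w q = some i := by
  obtain ⟨i, hi⟩ := Function.ne_iff.1 hq
  have hne : (Finset.univ.filter fun i => q i ≠ 0).Nonempty := ⟨i, by simpa using hi⟩
  exact ⟨_, dif_pos hne⟩

lemma delivered_eq_some_iff {i : Fin L} :
    delivered w q = some i ↔ w.2.1 = true ∧ transmitter w q = some i := by
  unfold delivered
  split_ifs with h <;> simp [h]

lemma delivered_zero (w : SlotNoise L) : delivered w 0 = none :=
  Option.eq_none_iff_forall_ne_some.2 fun _ h =>
    ne_zero_of_transmitter_eq_some (delivered_eq_some_iff.1 h).2 rfl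

lemma lengthStep_add (w : SlotNoise L) (q : Fin L → ℕ) (i : Fin L) :
    lengthStep w q i + (if delivered w q = some i then 1 else 0) =
      q i + if w.1 i then 1 else 0 := by
  unfold lengthStep
  by_cases h : delivered w q = some i
  · have := ne_zero_of_transmitter_eq_some (delivered_eq_some_iff.1 h).2
    simp only [h, if_true]
    omega
  · simp [h]

lemma sum_lengthStep_add (w : SlotNoise L) (hq : q ≠ 0) :
    ∑ i, lengthStep w q i + (if w.2.1 then 1 else 0) =
      ∑ i, q i + ∑ i, if w.1 i then 1 else 0 := by
  have hdeparture : (if w.2.1 then 1 else 0) = ∑ i, if delivered w q = some i then 1 else 0 := by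
    obtain ⟨j, hj⟩ := exists_transmitter_eq_some w hq
    simp only [delivered_eq_some_iff, hj, Option.some.injEq]
    by_cases hw : w.2.1 = true <;> simp [hw]
  rw [hdeparture, ← Finset.sum_add_distrib, ← Finset.sum_add_distrib]
  exact Finset.sum_congr rfl fun i _ => lengthStep_add w q i

lemma received_eq_iUnion : received L = ⋃ i, receivedFrom i := by
  ext x
  simp [received, receivedFrom, Option.isSome_iff_exists]

lemma pairwise_disjoint_receivedFrom :
    Pairwise fun i j : Fin L => Disjoint (receivedFrom i) (receivedFrom j) :=
  fun _ _ hij => Set.disjoint_left.2 fun _ hi hj => hij (Option.some.inj (hi.symm.trans hj))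

end QueueLengths

section Stationarity

variable {L : ℕ} {E : Type*} [MeasurableSpace E] (N : SensorNetwork L E)

instance : IsProbabilityMeasure (Measure.pi fun S : {S : Finset (Fin L) // S.Nonempty} =>
    uniformOn (Set.univ : Set S.1)) := by
  have (S : {S : Finset (Fin L) // S.Nonempty}) :
      IsProbabilityMeasure (uniformOn (Set.univ : Set S.1)) :=
    isProbabilityMeasure_uniformOn Set.finite_univ (@Set.univ_nonempty _ S.2.to_subtype)
  infer_instance

lemma measurePreserving_sampled (i : Fin L) :
    MeasurePreserving (fun w : SlotNoise L => w.1 i) N.slotLaw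
      (bernoulliMeasure true false (N.rate i)) :=
  (measurePreserving_eval (fun i => bernoulliMeasure true false (N.rate i)) i).comp
    measurePreserving_fst

lemma measurePreserving_success :
    MeasurePreserving (fun w : SlotNoise L => w.2.1) N.slotLaw
      (bernoulliMeasure true false N.success) :=
  measurePreserving_fst.comp measurePreserving_snd

lemma slotLaw_real_sampled (i : Fin L) : N.slotLaw.real {w | w.1 i = true} = N.rate i := by
  rw [← bernoulliMeasure_real_apply_of_mem_of_notMem (x := true) (y := false) (N.rate i)
    (.of_discrete (s := {true})) rfl (by simp)]
  exact (N.measurePreserving_sampled i).measureReal_preimage (s := {true})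
    MeasurableSet.of_discrete.nullMeasurableSet

lemma slotLaw_real_success : N.slotLaw.real {w | w.2.1 = true} = N.success := by
  rw [← bernoulliMeasure_real_apply_of_mem_of_notMem (x := true) (y := false) N.success
    (.of_discrete (s := {true})) rfl (by simp)]
  exact N.measurePreserving_success.measureReal_preimage (s := {true})
    MeasurableSet.of_discrete.nullMeasurableSet

lemma lintegral_success :
    ∫⁻ w, ((if w.2.1 then 1 else 0 : ℕ) : ℝ≥0∞) ∂N.slotLaw = ENNReal.ofReal N.success := by
  rw [← slotLaw_real_success, ofReal_measureReal, ← lintegral_indicator_one .of_discrete]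
  exact lintegral_congr fun w => by simp [Set.indicator]

lemma lintegral_sum_sampled :
    ∫⁻ w, ((∑ i, if w.1 i then 1 else 0 : ℕ) : ℝ≥0∞) ∂N.slotLaw =
      ENNReal.ofReal (∑ i, (N.rate i : ℝ)) := by
  rw [ENNReal.ofReal_sum_of_nonneg fun i _ => (N.rate i).2.1]
  simp only [Nat.cast_sum, Nat.cast_ite, Nat.cast_one, Nat.cast_zero]
  rw [lintegral_finsetSum _ fun i _ => .of_discrete]
  refine Finset.sum_congr rfl fun i _ => ?_
  rw [← slotLaw_real_sampled, ofReal_measureReal, ← lintegral_indicator_one .of_discrete]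
  exact lintegral_congr fun w => by simp [Set.indicator]

lemma lintegral_sum_lengthStep_zero :
    ∫⁻ w, ((∑ i, lengthStep w 0 i : ℕ) : ℝ≥0∞) ∂N.slotLaw =
      ENNReal.ofReal (∑ i, (N.rate i : ℝ)) := by
  simp only [lengthStep, delivered_zero, Pi.zero_apply, reduceCtorEq, if_false, zero_add,
    Nat.zero_sub, lintegral_sum_sampled]

lemma lintegral_sum_lengthStep_add {q : Fin L → ℕ} (hq : q ≠ 0) :
    ∫⁻ w, ((∑ i, lengthStep w q i : ℕ) : ℝ≥0∞) ∂N.slotLaw + ENNReal.ofReal N.success =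
      ((∑ i, q i : ℕ) : ℝ≥0∞) + ENNReal.ofReal (∑ i, (N.rate i : ℝ)) := by
  have hconst : ((∑ i, q i : ℕ) : ℝ≥0∞) = ∫⁻ _, ((∑ i, q i : ℕ) : ℝ≥0∞) ∂N.slotLaw := by simp
  rw [← lintegral_success, ← lintegral_sum_sampled, hconst, ← lintegral_add_left .of_discrete,
    ← lintegral_add_left .of_discrete]
  exact lintegral_congr fun w => by exact_mod_cast sum_lengthStep_add w hq

/-- The transition kernel of the Markov chain of queue-length vectors. -/
noncomputable def lengthKernel : Kernel (Fin L → ℕ) (Fin L → ℕ) :=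
  Kernel.ofFunOfCountable fun q => N.slotLaw.map fun w => lengthStep w q

lemma lengthKernel_apply (q : Fin L → ℕ) :
    N.lengthKernel q = N.slotLaw.map fun w => lengthStep w q := rfl

instance : IsMarkovKernel N.lengthKernel :=
  ⟨fun _ => Measure.isProbabilityMeasure_map Measurable.of_discrete.aemeasurable⟩

lemma lintegral_lengthKernel (q : Fin L → ℕ) (f : (Fin L → ℕ) → ℝ≥0∞) :
    ∫⁻ q', f q' ∂N.lengthKernel q = ∫⁻ w, f (lengthStep w q) ∂N.slotLaw :=
  lintegral_map .of_discrete .of_discrete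

lemma isStationary_iff {π : Measure (Fin L → ℕ)} :
    N.IsStationary π ↔ IsProbabilityMeasure π ∧ N.lengthKernel.Invariant π := by
  refine and_congr_right fun _ => ?_
  suffices (π.prod N.slotLaw).map (fun x => lengthStep x.2 x.1) = N.lengthKernel ∘ₘ π by
    rw [this, Kernel.Invariant]
  ext s hs
  rw [Measure.map_apply .of_discrete hs, Measure.prod_apply .of_discrete,
    Measure.bind_apply hs (Kernel.aemeasurable _)]
  simp only [lengthKernel_apply, Measure.map_apply .of_discrete hs]
  rfl

theorem existsUnique_isStationary (hstable : ∑ i, (N.rate i : ℝ) < N.success) :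
    ∃! π : Measure (Fin L → ℕ), N.IsStationary π := by
  simp only [isStationary_iff]
  have hload : 0 ≤ ∑ i, (N.rate i : ℝ) := Finset.sum_nonneg fun i _ => (N.rate i).2.1
  refine existsUnique_invariant_of_drift (a := 0) (V := fun q => ((∑ i, q i : ℕ) : NNReal))
    (ε := ENNReal.ofReal (N.success - ∑ i, (N.rate i : ℝ))) .of_discrete (by simpa) ?_ ?_
  · simp only [lintegral_lengthKernel, ENNReal.coe_natCast, lintegral_sum_lengthStep_zero]
    exact ENNReal.ofReal_ne_top
  · intro q hq
    simp only [lintegral_lengthKernel, ENNReal.coe_natCast]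
    refine ((ENNReal.add_left_inj (ENNReal.ofReal_ne_top (r := ∑ i, (N.rate i : ℝ)))).1 ?_).le
    rw [add_assoc, ← ENNReal.ofReal_add (by linarith) hload, sub_add_cancel,
      N.lintegral_sum_lengthStep_add hq]

variable {N} {π : Measure (Fin L → ℕ)}

lemma measureReal_receivedFrom (hπ : N.IsStationary π) (i : Fin L) :
    (π.prod N.slotLaw).real (receivedFrom i) = N.rate i := by
  obtain ⟨hprob, hinv⟩ := hπ
  set m := π.prod N.slotLaw
  have hident : IdentDistrib (fun x => (lengthStep x.2 x.1 i : ℝ)) (fun x => (x.1 i : ℝ)) m m := by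
    have hlengths : IdentDistrib (fun x => lengthStep x.2 x.1) Prod.fst m m :=
      ⟨Measurable.of_discrete.aemeasurable, measurable_fst.aemeasurable,
        hinv.trans measurePreserving_fst.map_eq.symm⟩
    exact hlengths.comp (u := fun q => (q i : ℝ)) .of_discrete
  have hchange : ∀ x : (Fin L → ℕ) × SlotNoise L, (lengthStep x.2 x.1 i : ℝ) - x.1 i =
      {x | x.2.1 i = true}.indicator 1 x - (receivedFrom i).indicator 1 x := fun x => by
    have hstep : (lengthStep x.2 x.1 i : ℝ) + (if delivered x.2 x.1 = some i then 1 else 0) =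
        x.1 i + if x.2.1 i then 1 else 0 := by exact_mod_cast lengthStep_add x.2 x.1 i
    classical
    rw [Set.indicator_apply, Set.indicator_apply, sub_eq_sub_iff_add_eq_add]
    convert hstep.trans (add_comm _ _) <;> rfl
  have hindicator : ∀ s : Set ((Fin L → ℕ) × SlotNoise L),
      Integrable (s.indicator (1 : (Fin L → ℕ) × SlotNoise L → ℝ)) m := fun s =>
    (integrable_const (1 : ℝ)).indicator .of_discrete
  have hbalance := integral_sub_eq_zero_of_identDistrib hident
    (by simp only [hchange]; exact (hindicator _).sub (hindicator _))
  simp only [hchange] at hbalance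
  rw [integral_sub (hindicator _) (hindicator _), integral_indicator_one .of_discrete,
    integral_indicator_one .of_discrete] at hbalance
  have hsampled : m.real {x | x.2.1 i = true} = N.rate i :=
    (measurePreserving_snd.measureReal_preimage MeasurableSet.of_discrete.nullMeasurableSet).trans
      (N.slotLaw_real_sampled i)
  linarith

lemma measureReal_received (hπ : N.IsStationary π) :
    (π.prod N.slotLaw).real (received L) = ∑ i, (N.rate i : ℝ) := by
  have := hπ.1
  rw [received_eq_iUnion, measureReal_iUnion_fintype pairwise_disjoint_receivedFrom
    fun _ => .of_discrete]
  exact Finset.sum_congr rfl fun i _ => measureReal_receivedFrom hπ i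

lemma cond_received_receivedFrom (hπ : N.IsStationary π) (i : Fin L) :
    ((π.prod N.slotLaw)[|received L]).real (receivedFrom i) =
      (N.rate i : ℝ) / ∑ j, (N.rate j : ℝ) := by
  have hinter : received L ∩ receivedFrom i = receivedFrom i := by
    rw [received_eq_iUnion]
    exact Set.inter_eq_right.2 (Set.subset_iUnion _ i)
  rw [measureReal_def, cond_apply .of_discrete, hinter, ENNReal.toReal_mul, ENNReal.toReal_inv,
    ← measureReal_def, ← measureReal_def, measureReal_receivedFrom hπ, measureReal_received hπ,
    inv_mul_eq_div]

end Stationarity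

end SensorNetwork

section Density

variable {ι : Type*} {X : ι → Type*} [∀ i, MeasurableSpace (X i)] (μ ν : ∀ i, Measure (X i))
  [∀ i, IsProbabilityMeasure (μ i)] [∀ i, IsProbabilityMeasure (ν i)] {ρ : ∀ i, X i → ℝ≥0∞}

lemma pi_eq_withDensity_prod [Fintype ι] (hρ : ∀ i, Measurable (ρ i))
    (h : ∀ i, μ i = (ν i).withDensity (ρ i)) :
    Measure.pi μ = (Measure.pi ν).withDensity fun y => ∏ i, ρ i (y i) := by
  refine Measure.pi_eq fun s hs => ?_
  have hindicator : ∀ y : ∀ i, X i, (Set.univ.pi s).indicator (fun y => ∏ i, ρ i (y i)) y =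
      ∏ i, (s i).indicator (ρ i) (y i) := by
    intro y
    by_cases hy : y ∈ Set.univ.pi s
    · rw [Set.indicator_of_mem hy]
      exact Finset.prod_congr rfl fun i _ => (Set.indicator_of_mem (hy i trivial) _).symm
    · rw [Set.indicator_of_notMem hy]
      obtain ⟨i, hi⟩ : ∃ i, y i ∉ s i := by simpa using hy
      exact (Finset.prod_eq_zero (Finset.mem_univ i) (Set.indicator_of_notMem hi _)).symm
  rw [withDensity_apply _ (.univ_pi hs), ← lintegral_indicator (.univ_pi hs),
    lintegral_congr hindicator, lintegral_prod_eq_prod_lintegral_of_indepFun Finset.univ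
      (fun i (y : ∀ i, X i) => (s i).indicator (ρ i) (y i))
      (iIndepFun_pi fun i => ((hρ i).indicator (hs i)).aemeasurable)
      (fun i => ((hρ i).indicator (hs i)).comp (measurable_pi_apply i))]
  refine Finset.prod_congr rfl fun i _ => ?_
  rw [(measurePreserving_eval ν i).lintegral_comp ((hρ i).indicator (hs i)),
    lintegral_indicator (hs i), ← withDensity_apply _ (hs i), h]

lemma lintegral_infinitePi_eq_lintegral_mul_prod (hρ : ∀ i, Measurable (ρ i)) (D : Finset ι)
    (h : ∀ i ∈ D, μ i = (ν i).withDensity (ρ i)) {f : (∀ i, X i) → ℝ≥0∞} (hf : Measurable f)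
    (hfD : DependsOn f D) :
    ∫⁻ y, f y ∂Measure.infinitePi μ =
      ∫⁻ y, f y * ∏ i ∈ D, ρ i (y i) ∂Measure.infinitePi ν := by
  classical
  have x : ∀ i, X i := fun i => (nonempty_of_isProbabilityMeasure (μ i)).some
  set g : (∀ i : D, X i) → ℝ≥0∞ := fun y => f (Function.updateFinset x D y)
  have hg : Measurable g := hf.comp measurable_updateFinset
  have hfg : ∀ y, f y = g (D.restrict y) := fun y =>
    hfD fun i hi => by simp [Function.updateFinset, Finset.mem_coe.1 hi]
  have hprod : ∀ y : ∀ i, X i, ∏ i ∈ D, ρ i (y i) = ∏ i : D, ρ i (D.restrict y i) := fun y =>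
    (Finset.prod_coe_sort D fun i => ρ i (y i)).symm
  simp_rw [hfg, hprod]
  have hdensity : Measurable fun y : ∀ i : D, X i => ∏ i : D, ρ i (y i) :=
    Finset.measurable_prod _ fun i _ => (hρ i).comp (measurable_pi_apply i)
  rw [lintegral_restrict_infinitePi μ hg,
    lintegral_restrict_infinitePi ν (f := fun y => g y * ∏ i : D, ρ i (y i)) (hg.mul hdensity),
    pi_eq_withDensity_prod (fun i : D => μ i) (fun i : D => ν i) (fun i => hρ i)
      (fun i => h i i.2), lintegral_withDensity_eq_lintegral_mul _ hdensity hg]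
  exact lintegral_congr fun y => mul_comm _ _

end Density

namespace SensorNetwork

instance : DiscreteMeasurableSpace (Finset ℤ) := ⟨fun _ => trivial⟩

section Packets

variable {L : ℕ} {E : Type*} [MeasurableSpace E] (N : SensorNetwork L E)

/-- The queue contents at the beginning of slot `k + 1`, as a function of the contents at the
beginning of slot `1` and of the randomness of the slots alone. -/
def queuePath (s : Fin L → Finset ℤ) (w : ℕ → SlotNoise L) : ℕ → Fin L → Finset ℤ
  | 0 => s
  | k + 1 => N.queueStep (w k) ((k : ℤ) + 1) (queuePath s w k)

/-- The packet received in slot `k + 1`, if any, named by its sampling slot and its sensor. -/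
def packet (s : Fin L → Finset ℤ) (w : ℕ → SlotNoise L) (k : ℕ) : Option (ℤ × Fin L) :=
  (delivered (w k) fun j => (N.queuePath s w k j).card).map fun i =>
    (N.discipline i (N.queuePath s w k i), i)

/-- The packets received in the slots `1, …, n`. -/
def packets (s : Fin L → Finset ℤ) (w : ℕ → SlotNoise L) (n : ℕ) : Finset (ℤ × Fin L) :=
  (Finset.range n).biUnion fun k => (N.packet s w k).toFinset

variable {N} {s : Fin L → Finset ℤ} {w : ℕ → SlotNoise L} {k m : ℕ} {x : ℤ × Fin L}

lemma queueAt_eq_queuePath (ω : Outcome L E) (k : ℕ) :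
    N.queueAt ω k = N.queuePath ω.1 ω.2.1 k := by
  induction k with
  | zero => rfl
  | succ k ih => rw [queueAt, queuePath, ih]

lemma packet_eq_some_iff :
    N.packet s w k = some x ↔
      delivered (w k) (fun j => (N.queuePath s w k j).card) = some x.2 ∧
        N.discipline x.2 (N.queuePath s w k x.2) = x.1 := by
  obtain ⟨t, i⟩ := x
  simp only [packet, Option.map_eq_some_iff, Prod.mk.injEq]
  constructor
  · rintro ⟨_, hdelivered, hslot, rfl⟩
    exact ⟨hdelivered, hslot⟩
  · rintro ⟨hdelivered, hslot⟩
    exact ⟨i, hdelivered, hslot, rfl⟩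

lemma mem_queuePath_of_packet_eq_some (h : N.packet s w k = some x) :
    x.1 ∈ N.queuePath s w k x.2 := by
  obtain ⟨hdelivered, hslot⟩ := packet_eq_some_iff.1 h
  have hcard := ne_zero_of_transmitter_eq_some (delivered_eq_some_iff.1 hdelivered).2
  rw [← hslot]
  exact N.discipline_mem _ _ (Finset.card_ne_zero.1 hcard)

lemma mem_queuePath_succ :
    x.1 ∈ N.queuePath s w (k + 1) x.2 ↔
      (x.1 ∈ N.queuePath s w k x.2 ∧ N.packet s w k ≠ some x) ∨
        ((w k).1 x.2 = true ∧ x.1 = (k : ℤ) + 1) := by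
  rw [ne_eq, packet_eq_some_iff, queuePath, queueStep]
  by_cases hdelivered : delivered (w k) (fun j => (N.queuePath s w k j).card) = some x.2 <;>
    by_cases hsampled : (w k).1 x.2 = true <;>
    simp [hdelivered, hsampled, and_comm, eq_comm] <;> tauto

lemma le_of_mem_queuePath (hs : ∀ i, ∀ t ∈ s i, t ≤ 0) (h : x.1 ∈ N.queuePath s w k x.2) :
    x.1 ≤ k := by
  induction k with
  | zero => exact hs _ _ h
  | succ k ih =>
    push_cast
    rcases mem_queuePath_succ.1 h with ⟨hmem, -⟩ | ⟨-, heq⟩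
    · linarith [ih hmem]
    · exact heq.le

lemma packet_ne_some_of_lt (hs : ∀ i, ∀ t ∈ s i, t ≤ 0) (hkm : k < m)
    (h : N.packet s w k = some x) : N.packet s w m ≠ some x := by
  have hle := le_of_mem_queuePath hs (mem_queuePath_of_packet_eq_some h)
  suffices hgone : x.1 ∉ N.queuePath s w m x.2 from
    fun h' => hgone (mem_queuePath_of_packet_eq_some h')
  induction m, Nat.succ_le_of_lt hkm using Nat.le_induction with
  | base =>
    rw [mem_queuePath_succ]
    rintro (⟨-, hne⟩ | ⟨-, heq⟩)
    · exact hne h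
    · omega
  | succ m hm ih =>
    rw [mem_queuePath_succ]
    rintro (⟨hmem, -⟩ | ⟨-, heq⟩)
    · exact ih (by omega) hmem
    · omega

lemma eq_of_packet_eq_some (hs : ∀ i, ∀ t ∈ s i, t ≤ 0) (hk : N.packet s w k = some x)
    (hm : N.packet s w m = some x) : k = m :=
  eq_of_le_of_ge (not_lt.1 fun hlt => packet_ne_some_of_lt hs hlt hm hk)
    (not_lt.1 fun hlt => packet_ne_some_of_lt hs hlt hk hm)

lemma obsAt_of_packet_eq_some (h : N.packet s w k = some x) (X : ℤ × Fin L → E) :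
    N.obsAt (s, w, X) k = Sum.inr (Sum.inr (x.2, x.1, X x)) := by
  obtain ⟨hdelivered, hslot⟩ := packet_eq_some_iff.1 h
  obtain ⟨hsuccess, htransmitter⟩ := delivered_eq_some_iff.1 hdelivered
  simp only [obsAt, slotObs, queueAt_eq_queuePath, hsuccess, htransmitter, if_true, hslot]

lemma obsAt_of_packet_eq_none (h : N.packet s w k = none) (X : ℤ × Fin L → E) :
    N.obsAt (s, w, X) k =
      if (transmitter (w k) fun j => (N.queuePath s w k j).card).isSome then
        Sum.inr (Sum.inl ()) else Sum.inl () := by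
  simp only [packet, Option.map_eq_none_iff, delivered] at h
  simp only [obsAt, slotObs, queueAt_eq_queuePath]
  cases htransmitter : transmitter (w k) fun j => (N.queuePath s w k j).card with
  | none => rfl
  | some i =>
    have hfailure : (w k).2.1 = false := by simpa [htransmitter] using h
    simp [hfailure]

lemma dependsOn_obs (s : Fin L → Finset ℤ) (w : ℕ → SlotNoise L) (n : ℕ) :
    DependsOn (fun X : ℤ × Fin L → E => N.obs n (s, w, X)) (N.packets s w n) := by
  intro X X' h
  funext k
  change N.obsAt (s, w, X) k = N.obsAt (s, w, X') k
  cases hp : N.packet s w k with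
  | none => rw [obsAt_of_packet_eq_none hp, obsAt_of_packet_eq_none hp]
  | some x =>
    have hx : x ∈ N.packets s w n :=
      Finset.mem_biUnion.2 ⟨k, Finset.mem_range.2 k.2, by simp [hp]⟩
    rw [obsAt_of_packet_eq_some hp, obsAt_of_packet_eq_some hp, h x hx]

end Packets

section Measurability

variable {L : ℕ} {E : Type*} [MeasurableSpace E] (N : SensorNetwork L E)

lemma measurable_queueAt (k : ℕ) : Measurable fun ω : Outcome L E => N.queueAt ω k := by
  induction k with
  | zero => exact measurable_fst
  | succ k ih =>
    have hstep : Measurable fun p : SlotNoise L × (Fin L → Finset ℤ) =>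
      N.queueStep p.1 ((k : ℤ) + 1) p.2 := .of_discrete
    exact hstep.comp (Measurable.prodMk (by fun_prop) ih)

lemma measurable_slotObs (w : SlotNoise L) (s : Fin L → Finset ℤ) :
    Measurable fun X : ℤ × Fin L → E => N.slotObs w s X := by
  unfold slotObs
  cases transmitter w fun j => (s j).card with
  | none => exact measurable_const
  | some i =>
    dsimp only
    split_ifs
    · exact measurable_inr.comp (measurable_inr.comp
        (measurable_const.prodMk (measurable_const.prodMk (measurable_pi_apply _))))
    · exact measurable_const

lemma measurable_obsAt (k : ℕ) : Measurable fun ω : Outcome L E => N.obsAt ω k := by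
  have hslotObs : Measurable fun p : (SlotNoise L × (Fin L → Finset ℤ)) × (ℤ × Fin L → E) =>
      N.slotObs p.1.1 p.1.2 p.2 :=
    measurable_from_prod_countable_right fun p => N.measurable_slotObs p.1 p.2
  have hinput : Measurable fun ω : Outcome L E => ((ω.2.1 k, N.queueAt ω k), ω.2.2) :=
    (Measurable.prodMk (by fun_prop) (N.measurable_queueAt k)).prodMk (by fun_prop)
  simpa only [Function.comp_def, obsAt] using hslotObs.comp hinput

lemma measurable_obs (n : ℕ) : Measurable (N.obs n) :=
  measurable_pi_lambda _ fun k => N.measurable_obsAt k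

instance (init : PMF (Fin L → Finset ℤ)) (ν : WithTop ℤ) :
    IsProbabilityMeasure (N.law init ν) := by
  unfold law; infer_instance

instance (init : PMF (Fin L → Finset ℤ)) (ν : WithTop ℤ) (n : ℕ) :
    IsProbabilityMeasure (N.obsLaw init ν n) :=
  Measure.isProbabilityMeasure_map (N.measurable_obs n).aemeasurable

lemma lintegral_law (init : PMF (Fin L → Finset ℤ)) (ν : WithTop ℤ) {f : Outcome L E → ℝ≥0∞}
    (hf : Measurable f) :
    ∫⁻ ω, f ω ∂N.law init ν = ∫⁻ s, ∫⁻ w, ∫⁻ X, f (s, w, X)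
      ∂Measure.infinitePi (N.sampleLaw ν) ∂Measure.infinitePi (fun _ : ℕ => N.slotLaw)
      ∂init.toMeasure := by
  rw [law, lintegral_prod _ hf.aemeasurable]
  refine lintegral_congr fun s => ?_
  exact lintegral_prod (fun p => f (s, p)) (hf.comp measurable_prodMk_left).aemeasurable

lemma ae_toMeasure_mem_support (init : PMF (Fin L → Finset ℤ)) :
    ∀ᵐ s ∂init.toMeasure, s ∈ init.support := by
  rw [← PMF.restrict_toMeasure_support]
  exact ae_restrict_mem .of_discrete

end Measurability

section Likelihood

variable {L : ℕ} {E : Type*} [MeasurableSpace E] (N : SensorNetwork L E) (ν : WithTop ℤ)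

/-- The likelihood ratio of `P_ν` against `P_∞` for the measurement of sensor `x.2` in slot
`x.1`. -/
noncomputable def sampleLR (x : ℤ × Fin L) : E → ℝ≥0∞ :=
  (N.sampleLaw ν x).rnDeriv (N.sampleLaw ⊤ x)

/-- The likelihood ratio of `P_ν` against `P_∞` contributed by the observation in one slot: only
received measurements carry information about the change. -/
noncomputable def slotLR : SlotObs L E → ℝ≥0∞
  | Sum.inr (Sum.inr (i, t, z)) => N.sampleLR ν (t, i) z
  | _ => 1

variable {N} {ν}

lemma sampleLaw_of_le {x : ℤ × Fin L} (h : x.1 ≤ ν) : N.sampleLaw ν x = N.pre x.2 := if_pos h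

lemma sampleLaw_of_lt {x : ℤ × Fin L} (h : ν < x.1) : N.sampleLaw ν x = N.post x.2 :=
  if_neg h.not_ge

lemma sampleLaw_absolutelyContinuous_top
    (hac : ∀ i, (N.post i : Measure E) ≪ (N.pre i : Measure E)) (x : ℤ × Fin L) :
    N.sampleLaw ν x ≪ N.sampleLaw ⊤ x := by
  rw [sampleLaw_of_le (ν := ⊤) le_top]
  rcases le_or_gt (x.1 : WithTop ℤ) ν with h | h
  · rw [sampleLaw_of_le h]
  · rw [sampleLaw_of_lt h]
    exact hac x.2

lemma measurable_slotLR : Measurable (N.slotLR ν) :=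
  measurable_fun_sum measurable_const <| measurable_fun_sum measurable_const <|
    measurable_from_prod_countable_right fun _ => measurable_from_prod_countable_right fun _ =>
      Measure.measurable_rnDeriv _ _

lemma measurable_prod_slotLR (n : ℕ) :
    Measurable fun y : Fin n → SlotObs L E => ∏ k, N.slotLR ν (y k) :=
  Finset.measurable_prod _ fun k _ => measurable_slotLR.comp (measurable_pi_apply k)

lemma slotLR_obsAt (s : Fin L → Finset ℤ) (w : ℕ → SlotNoise L) (X : ℤ × Fin L → E) (k : ℕ) :
    N.slotLR ν (N.obsAt (s, w, X) k) =
      ∏ x ∈ (N.packet s w k).toFinset, N.sampleLR ν x (X x) := by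
  cases h : N.packet s w k with
  | none =>
    rw [obsAt_of_packet_eq_none h]
    split_ifs <;> simp [slotLR]
  | some x =>
    rw [obsAt_of_packet_eq_some h]
    simp [slotLR]

lemma prod_slotLR_obs {s : Fin L → Finset ℤ} (hs : ∀ i, ∀ t ∈ s i, t ≤ 0)
    (w : ℕ → SlotNoise L) (X : ℤ × Fin L → E) (n : ℕ) :
    ∏ k, N.slotLR ν (N.obs n (s, w, X) k) = ∏ x ∈ N.packets s w n, N.sampleLR ν x (X x) := by
  rw [packets, Finset.prod_biUnion]
  · rw [← Fin.prod_univ_eq_prod_range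
      (fun k => ∏ x ∈ (N.packet s w k).toFinset, N.sampleLR ν x (X x)) n]
    exact Finset.prod_congr rfl fun k _ => slotLR_obsAt s w X k
  · intro k _ m _ hkm
    refine Finset.disjoint_left.2 fun x hk hm => hkm ?_
    exact eq_of_packet_eq_some hs (Option.mem_toFinset.1 hk) (Option.mem_toFinset.1 hm)

section

variable (hac : ∀ i, (N.post i : Measure E) ≪ (N.pre i : Measure E))
  {init : PMF (Fin L → Finset ℤ)}

include hac

lemma obsLaw_eq_withDensity (hinit : ∀ s ∈ init.support, ∀ i, ∀ t ∈ s i, t ≤ 0) (n : ℕ) :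
    N.obsLaw init ν n =
      (N.obsLaw init ⊤ n).withDensity fun y => ∏ k, N.slotLR ν (y k) := by
  ext A hA
  have hdensity : Measurable (A.indicator fun y => ∏ k, N.slotLR ν (y k)) :=
    (measurable_prod_slotLR n).indicator hA
  have hone : Measurable (A.indicator (1 : (Fin n → SlotObs L E) → ℝ≥0∞)) :=
    measurable_one.indicator hA
  have hobs := N.measurable_obs n
  rw [withDensity_apply _ hA, ← lintegral_indicator hA, ← lintegral_indicator_one hA,
    obsLaw, obsLaw, lintegral_map hone hobs, lintegral_map hdensity hobs,
    lintegral_law N init ν (f := fun ω => A.indicator 1 (N.obs n ω)) (hone.comp hobs),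
    lintegral_law N init ⊤ (f := fun ω => A.indicator (fun y => ∏ k, N.slotLR ν (y k)) (N.obs n ω))
      (hdensity.comp hobs)]
  refine lintegral_congr_ae ?_
  filter_upwards [ae_toMeasure_mem_support init] with s hs
  refine lintegral_congr fun w => ?_
  rw [lintegral_infinitePi_eq_lintegral_mul_prod (N.sampleLaw ν) (N.sampleLaw ⊤)
    (fun x => Measure.measurable_rnDeriv _ _) (N.packets s w n)
    (fun x _ => (Measure.withDensity_rnDeriv_eq _ _
      (sampleLaw_absolutelyContinuous_top hac x)).symm)
    (f := fun X => A.indicator 1 (N.obs n (s, w, X)))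
    ((hone.comp hobs).comp (measurable_prodMk_left.comp measurable_prodMk_left))
    (fun X X' h => congrArg (A.indicator 1) (dependsOn_obs s w n h))]
  refine lintegral_congr fun X => ?_
  change A.indicator 1 (N.obs n (s, w, X)) * ∏ x ∈ N.packets s w n, N.sampleLR ν x (X x) =
    A.indicator (fun y => ∏ k, N.slotLR ν (y k)) (N.obs n (s, w, X))
  rw [← prod_slotLR_obs (hinit s hs)]
  by_cases hmem : N.obs n (s, w, X) ∈ A <;> simp [hmem]

lemma ae_toReal_sampleLR_pos :
    ∀ᵐ X ∂Measure.infinitePi (N.sampleLaw ν), ∀ x, 0 < (N.sampleLR ν x (X x)).toReal := by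
  refine ae_all_iff.2 fun x => ?_
  have hx := sampleLaw_absolutelyContinuous_top (ν := ν) hac x
  have hpos : ∀ᵐ z ∂N.sampleLaw ν x, 0 < (N.sampleLR ν x z).toReal := by
    filter_upwards [Measure.rnDeriv_pos hx,
      hx.ae_le (Measure.rnDeriv_ne_top (N.sampleLaw ν x) (N.sampleLaw ⊤ x))] with z hpos htop
    exact ENNReal.toReal_pos hpos.ne' htop
  exact (measurePreserving_eval_infinitePi (N.sampleLaw ν) x).quasiMeasurePreserving.ae hpos

lemma logLR_ae_eq_sum (hinit : ∀ s ∈ init.support, ∀ i, ∀ t ∈ s i, t ≤ 0) (n : ℕ) :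
    ∀ᵐ ω ∂N.law init ν,
      N.logLR init ν n ω =
        ∑ k ∈ Finset.range n, Real.log (N.slotLR ν (N.obsAt ω k)).toReal := by
  have hrnDeriv : ∀ᵐ ω ∂N.law init ν,
      (N.obsLaw init ν n).rnDeriv (N.obsLaw init ⊤ n) (N.obs n ω) =
        ∏ k, N.slotLR ν (N.obs n ω k) := by
    have heq := obsLaw_eq_withDensity (ν := ν) hac hinit n
    have hderiv := Measure.rnDeriv_withDensity (N.obsLaw init ⊤ n)
      (measurable_prod_slotLR (N := N) (ν := ν) n)
    rw [← heq] at hderiv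
    have habs : N.obsLaw init ν n ≪ N.obsLaw init ⊤ n :=
      heq ▸ withDensity_absolutelyContinuous _ _
    exact ae_of_ae_map (N.measurable_obs n).aemeasurable (habs.ae_le hderiv)
  have hpos : ∀ᵐ ω ∂N.law init ν, ∀ x, 0 < (N.sampleLR ν x (ω.2.2 x)).toReal :=
    (Measure.quasiMeasurePreserving_snd.comp Measure.quasiMeasurePreserving_snd).ae
      (ae_toReal_sampleLR_pos hac)
  filter_upwards [hrnDeriv, hpos] with ω hrnDeriv hpos
  have hne : ∀ k, (N.slotLR ν (N.obsAt ω k)).toReal ≠ 0 := fun k => by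
    rw [show ω = (ω.1, ω.2.1, ω.2.2) from rfl, slotLR_obsAt, ENNReal.toReal_prod]
    exact Finset.prod_ne_zero_iff.2 fun x _ => (hpos x).ne'
  rw [logLR, llr, hrnDeriv, ENNReal.toReal_prod]
  simp only [obs]
  rw [Real.log_prod fun k _ => hne k.1,
    ← Fin.sum_univ_eq_sum_range (fun k => Real.log (N.slotLR ν (N.obsAt ω k)).toReal) n]

end

end Likelihood

end SensorNetwork

section StrongLaw

variable {Ω F : Type*} {mΩ : MeasurableSpace Ω} {mF : MeasurableSpace F}
  {P : Measure Ω} {μ ν : Measure F} {Z : ℕ → Ω → F} {f : F → ℝ}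

lemma ae_tendsto_average_of_integrable (hZ : ∀ k, HasLaw (Z k) μ P)
    (hindep : Pairwise fun k m => Z k ⟂ᵢ[P] Z m) (hf : Measurable f) (hint : Integrable f μ) :
    ∀ᵐ ω ∂P, Tendsto (fun n : ℕ => (∑ k ∈ Finset.range n, f (Z k ω)) / n) atTop
      (𝓝 (∫ z, f z ∂μ)) := by
  have hint' : Integrable (fun ω => f (Z 0 ω)) P :=
    (integrable_map_measure ((hZ 0).map_eq ▸ hf.aestronglyMeasurable) (hZ 0).aemeasurable).1
      ((hZ 0).map_eq ▸ hint)
  have hlim := strong_law_ae_real (fun k ω => f (Z k ω)) hint'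
    (fun k m hkm => (hindep hkm).comp hf hf)
    (fun k => ((hZ k).identDistrib (hZ 0)).comp hf)
  rwa [show ∫ ω, f (Z 0 ω) ∂P = ∫ z, f z ∂μ from
    (hZ 0).integral_comp hf.aestronglyMeasurable] at hlim

lemma integrable_min_natCast [IsFiniteMeasure μ] (hf : Measurable f) (hf0 : ∀ z, 0 ≤ f z)
    (M : ℕ) : Integrable (fun z => min (f z) M) μ :=
  .of_bound (hf.min measurable_const).aestronglyMeasurable M <| ae_of_all _ fun z => by
    rw [Real.norm_of_nonneg (le_min (hf0 z) M.cast_nonneg)]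
    exact min_le_right _ _

lemma tendsto_integral_min_natCast_atTop [IsFiniteMeasure μ] (hf : Measurable f)
    (hf0 : ∀ z, 0 ≤ f z) (hint : ¬ Integrable f μ) :
    Tendsto (fun M : ℕ => ∫ z, min (f z) M ∂μ) atTop atTop := by
  have hmonotone : Tendsto (fun M : ℕ => ∫⁻ z, ENNReal.ofReal (min (f z) M) ∂μ) atTop
      (𝓝 (∫⁻ z, ENNReal.ofReal (f z) ∂μ)) := by
    refine lintegral_tendsto_of_tendsto_of_monotone
      (fun M => (hf.min measurable_const).ennreal_ofReal.aemeasurable)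
      (ae_of_all _ fun z M M' h => ENNReal.ofReal_le_ofReal
        (min_le_min le_rfl (Nat.cast_le.2 h)))
      (ae_of_all _ fun z => tendsto_const_nhds.congr' ?_)
    filter_upwards [eventually_ge_atTop ⌈f z⌉₊] with M hM
    rw [min_eq_left (Nat.ceil_le.1 hM)]
  have htop : ∫⁻ z, ENNReal.ofReal (f z) ∂μ = ∞ := by
    by_contra hne
    exact hint ((lintegral_ofReal_ne_top_iff_integrable hf.aestronglyMeasurable
      (ae_of_all _ hf0)).1 hne)
  rw [htop] at hmonotone
  refine ENNReal.tendsto_ofReal_nhds_top.1 (hmonotone.congr fun M => ?_)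
  exact (ofReal_integral_eq_lintegral_ofReal (integrable_min_natCast hf hf0 M)
    (ae_of_all _ fun z => le_min (hf0 z) M.cast_nonneg)).symm

lemma min_eq_min_max_sub_max_neg {x M : ℝ} (hM : 0 ≤ M) :
    min x M = min (max x 0) M - max (-x) 0 := by
  rcases le_total x 0 with h | h
  · rw [max_eq_right h, max_eq_left (neg_nonneg.2 h), min_eq_left hM, min_eq_left (h.trans hM)]
    ring
  · rw [max_eq_left h, max_eq_right (neg_nonpos.2 h), sub_zero]

lemma ae_tendsto_average_atTop [IsFiniteMeasure μ] (hZ : ∀ k, HasLaw (Z k) μ P)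
    (hindep : Pairwise fun k m => Z k ⟂ᵢ[P] Z m) (hf : Measurable f)
    (hneg : Integrable (fun z => max (-f z) 0) μ) (hint : ¬ Integrable f μ) :
    ∀ᵐ ω ∂P, Tendsto (fun n : ℕ => (∑ k ∈ Finset.range n, f (Z k ω)) / n) atTop atTop := by
  set pos : F → ℝ := fun z => max (f z) 0
  have hpos : Measurable pos := hf.max measurable_const
  have hpos_nonneg : ∀ z, 0 ≤ pos z := fun z => le_max_right _ _
  have hpos_int : ¬ Integrable pos μ := fun h => hint <|
    (h.sub hneg).congr (ae_of_all _ fun z => max_zero_sub_max_neg_zero_eq_self (f z))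
  have hmin (M : ℕ) : (fun z => min (f z) (M : ℝ)) =
      fun z => min (pos z) (M : ℝ) - max (-f z) 0 :=
    funext fun z => min_eq_min_max_sub_max_neg M.cast_nonneg
  have hmin_int (M : ℕ) : Integrable (fun z => min (f z) (M : ℝ)) μ := by
    rw [hmin]
    exact (integrable_min_natCast hpos hpos_nonneg M).sub hneg
  have hmin_lim : Tendsto (fun M : ℕ => ∫ z, min (f z) (M : ℝ) ∂μ) atTop atTop := by
    simp only [hmin, integral_sub (integrable_min_natCast hpos hpos_nonneg _) hneg]
    exact tendsto_atTop_add_const_right _ _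
      (tendsto_integral_min_natCast_atTop hpos hpos_nonneg hpos_int)
  filter_upwards [ae_all_iff.2 fun M : ℕ =>
    ae_tendsto_average_of_integrable hZ hindep (hf.min measurable_const) (hmin_int M)] with ω hω
  refine tendsto_atTop.2 fun b => ?_
  obtain ⟨M, hM⟩ := (hmin_lim.eventually_gt_atTop b).exists
  filter_upwards [(hω M).eventually_const_lt hM] with n hn
  refine hn.le.trans (div_le_div_of_nonneg_right ?_ n.cast_nonneg)
  exact Finset.sum_le_sum fun k _ => min_le_left _ _

lemma mul_max_neg_log_le_one {x : ℝ} (hx : 0 ≤ x) : x * max (-Real.log x) 0 ≤ 1 := by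
  rcases hx.eq_or_lt with rfl | hpos
  · simp
  rw [mul_max_of_nonneg _ _ hx, mul_zero]
  refine max_le ?_ zero_le_one
  have hlog := mul_le_mul_of_nonneg_left (Real.one_sub_inv_le_log_of_pos hpos) hx
  rw [mul_sub, mul_inv_cancel₀ hpos.ne'] at hlog
  linarith

lemma integrable_max_neg_llr [SigmaFinite μ] [IsFiniteMeasure ν] (hμν : μ ≪ ν) :
    Integrable (fun z => max (-llr μ ν z) 0) μ := by
  have hmeas : Measurable fun z => max (-llr μ ν z) 0 :=
    (measurable_llr μ ν).neg.max measurable_const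
  refine (lintegral_ofReal_ne_top_iff_integrable hmeas.aestronglyMeasurable
    (ae_of_all _ fun z => le_max_right _ _)).1 (ne_of_lt ?_)
  rw [← lintegral_rnDeriv_mul hμν hmeas.ennreal_ofReal.aemeasurable]
  refine lt_of_le_of_lt (lintegral_mono_ae (g := fun _ => 1) ?_) (by simp)
  filter_upwards [Measure.rnDeriv_ne_top μ ν] with z hz
  rw [← ENNReal.ofReal_toReal hz, ← ENNReal.ofReal_mul ENNReal.toReal_nonneg,
    ← ENNReal.ofReal_one]
  exact ENNReal.ofReal_le_ofReal (mul_max_neg_log_le_one ENNReal.toReal_nonneg)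

lemma ae_tendsto_average_llr [IsProbabilityMeasure μ] [IsProbabilityMeasure ν]
    (hZ : ∀ k, HasLaw (Z k) μ P) (hindep : Pairwise fun k m => Z k ⟂ᵢ[P] Z m) (hμν : μ ≪ ν) :
    ∀ᵐ ω ∂P, Tendsto
      (fun n : ℕ => (((∑ k ∈ Finset.range n, llr μ ν (Z k ω)) / n : ℝ) : EReal)) atTop
      (𝓝 (klDiv μ ν : EReal)) := by
  by_cases hint : Integrable (llr μ ν) μ
  · filter_upwards [ae_tendsto_average_of_integrable hZ hindep (measurable_llr μ ν) hint]
      with ω hω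
    rw [← toReal_klDiv_of_measure_eq hμν (by simp)] at hω
    rw [← EReal.coe_ennreal_toReal (klDiv_ne_top hμν hint)]
    exact EReal.tendsto_coe.2 hω
  · rw [klDiv_of_not_integrable hint, EReal.coe_ennreal_top]
    filter_upwards [ae_tendsto_average_atTop hZ hindep (measurable_llr μ ν)
      (integrable_max_neg_llr hμν) hint] with ω hω
    exact EReal.tendsto_coe_nhds_top_iff.2 hω

lemma indepFun_eval_infinitePi {ι : Type*} {G : ι → Type*} [∀ i, MeasurableSpace (G i)]
    (κ : ∀ i, Measure (G i)) [∀ i, IsProbabilityMeasure (κ i)] {i j : ι} (hij : i ≠ j) :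
    (fun X : ∀ i, G i => X i) ⟂ᵢ[Measure.infinitePi κ] fun X => X j :=
  (iIndepFun_infinitePi (P := κ) (X := fun _ => id) fun _ => measurable_id).indepFun hij

end StrongLaw

section Limits

lemma tendsto_coe_finsetSum {ι α : Type*} {l : Filter α} {a : ι → α → ℝ} {d : ι → ℝ≥0∞}
    (s : Finset ι) (h : ∀ i ∈ s, Tendsto (fun n => (a i n : EReal)) l (𝓝 (d i : EReal))) :
    Tendsto (fun n => ((∑ i ∈ s, a i n : ℝ) : EReal)) l
      (𝓝 ((∑ i ∈ s, d i : ℝ≥0∞) : EReal)) := by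
  classical
  induction s using Finset.induction_on with
  | empty => simpa using tendsto_const_nhds
  | insert i s hi ih =>
    simp only [Finset.sum_insert hi, EReal.coe_add, EReal.coe_ennreal_add]
    exact (EReal.continuousAt_add (p := ((d i : EReal), ((∑ i ∈ s, d i : ℝ≥0∞) : EReal)))
      (Or.inr (EReal.coe_ennreal_ne_bot _)) (Or.inl (EReal.coe_ennreal_ne_bot _))).tendsto.comp
      ((h i (Finset.mem_insert_self _ _)).prodMk_nhds
        (ih fun j hj => h j (Finset.mem_insert_of_mem hj)))

lemma tendsto_coe_mul {α : Type*} {l : Filter α} {c a : α → ℝ} {r : ℝ} (hr : 0 < r) {d : ℝ≥0∞}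
    (hc : Tendsto c l (𝓝 r)) (ha : Tendsto (fun n => (a n : EReal)) l (𝓝 (d : EReal))) :
    Tendsto (fun n => ((c n * a n : ℝ) : EReal)) l
      (𝓝 ((ENNReal.ofReal r * d : ℝ≥0∞) : EReal)) := by
  have hr' : (r : EReal) ≠ 0 := by exact_mod_cast hr.ne'
  rw [EReal.coe_ennreal_mul, EReal.coe_ennreal_ofReal, max_eq_left hr.le]
  simp only [EReal.coe_mul]
  exact (EReal.continuousAt_mul (p := ((r : EReal), (d : EReal))) (.inl hr') (.inl hr')
    (.inl (EReal.coe_ne_bot r)) (.inl (EReal.coe_ne_top r))).tendsto.comp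
    ((EReal.tendsto_coe.2 hc).prodMk_nhds ha)

lemma tendsto_div_natCast_zero_iff {B : ℕ → ℝ} :
    Tendsto (fun n : ℕ => B n / n) atTop (𝓝 0) ↔
      ∀ ε > 0, ∃ K, ∀ n : ℕ, |B n| ≤ ε * n + K := by
  have hdist (n : ℕ) : dist (B n / n) 0 = |B n| / n := by
    rw [Real.dist_0_eq_abs, abs_div, Nat.abs_cast]
  simp only [Metric.tendsto_atTop, hdist]
  constructor
  · intro h ε hε
    obtain ⟨n₀, hn₀⟩ := h ε hε
    refine ⟨∑ n ∈ Finset.range (n₀ + 1), |B n|, fun n => ?_⟩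
    have hsum : 0 ≤ ∑ n ∈ Finset.range (n₀ + 1), |B n| := by positivity
    rcases lt_or_ge n (n₀ + 1) with hn | hn
    · have := Finset.single_le_sum (fun n _ => abs_nonneg (B n)) (Finset.mem_range.2 hn)
      linarith [mul_nonneg hε.le n.cast_nonneg]
    · have hlt := hn₀ n (by omega)
      rw [div_lt_iff₀ (by exact_mod_cast Nat.zero_lt_of_lt hn)] at hlt
      linarith
  · intro h ε hε
    obtain ⟨K, hK⟩ := h (ε / 2) (half_pos hε)
    obtain ⟨n₀, hn₀⟩ := exists_nat_gt (K / (ε / 2))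
    refine ⟨n₀ + 1, fun n hn => ?_⟩
    have hlt : K / (ε / 2) < n := hn₀.trans (by exact_mod_cast hn)
    rw [div_lt_iff₀ (half_pos hε)] at hlt
    rw [div_lt_iff₀ (by exact_mod_cast Nat.zero_lt_of_lt hn)]
    linarith [hK n]

lemma tendsto_average_congr {x y : ℕ → ℝ} {r : ℝ} (hxy : x =ᶠ[atTop] y)
    (hx : Tendsto (fun n : ℕ => (∑ k ∈ Finset.range n, x k) / n) atTop (𝓝 r)) :
    Tendsto (fun n : ℕ => (∑ k ∈ Finset.range n, y k) / n) atTop (𝓝 r) := by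
  have hdiff : Tendsto (fun k => y k - x k) atTop (𝓝 0) :=
    tendsto_const_nhds.congr' (hxy.mono fun k hk => (sub_eq_zero.2 hk.symm).symm)
  refine (add_zero r ▸ hx.add hdiff.cesaro).congr fun n => ?_
  rw [Finset.sum_sub_distrib, inv_mul_eq_div, ← add_div, add_sub_cancel]

lemma tendsto_div_zero_of_le_or_step_le {W x : ℕ → ℝ} {C δ : ℝ} (hδ : δ ≤ 0) (hW : ∀ n, 0 ≤ W n)
    (hstep : ∀ n, W (n + 1) ≤ C ∨ W (n + 1) ≤ W n + x n)
    (hx : Tendsto (fun n : ℕ => (∑ k ∈ Finset.range n, x k) / n) atTop (𝓝 δ)) :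
    Tendsto (fun n : ℕ => W n / n) atTop (𝓝 0) := by
  set B : ℕ → ℝ := fun n => ∑ k ∈ Finset.range n, x k - δ * n
  have hB : Tendsto (fun n : ℕ => B n / n) atTop (𝓝 0) := by
    refine (sub_self δ ▸ hx.sub_const δ).congr' ?_
    filter_upwards [eventually_ne_atTop 0] with n hn
    rw [sub_div, mul_div_cancel_right₀ _ (Nat.cast_ne_zero.2 hn)]
  rw [tendsto_div_natCast_zero_iff] at hB ⊢
  intro ε hε
  obtain ⟨K, hK⟩ := hB (ε / 2) (half_pos hε)
  have hbound : ∀ n, W n ≤ B n + ε / 2 * n + max (C + K) (W 0) := fun n => by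
    induction n with
    | zero => simp [B]
    | succ n ih =>
      rcases hstep n with h | h
      · linarith [neg_le_of_abs_le (hK (n + 1)), le_max_left (C + K) (W 0)]
      · simp only [B, Finset.sum_range_succ] at ih ⊢
        push_cast
        linarith
  refine ⟨K + max (C + K) (W 0), fun n => ?_⟩
  rw [abs_of_nonneg (hW n)]
  linarith [hbound n, le_of_abs_le (hK n)]

lemma sum_range_ite_eq_sum_range_count {M : Type*} [AddCommMonoid M] (p : ℕ → Prop)
    [DecidablePred p] (f : ℕ → M) (n : ℕ) :
    ∑ k ∈ Finset.range n, (if p k then f k else 0) =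
      ∑ m ∈ Finset.range (Nat.count p n), f (Nat.nth p m) := by
  induction n with
  | zero => simp
  | succ n ih =>
    rw [Finset.sum_range_succ, ih, Nat.count_succ]
    split_ifs with h
    · rw [Finset.sum_range_succ, Nat.nth_count h]
    · simp

lemma infinite_of_tendsto_count_div {p : ℕ → Prop} [DecidablePred p] {r : ℝ} (hr : r ≠ 0)
    (h : Tendsto (fun n : ℕ => (Nat.count p n : ℝ) / n) atTop (𝓝 r)) :
    {k | p k}.Infinite := fun hfinite =>
  hr <| tendsto_nhds_unique h <| squeeze_zero (fun _ => by positivity)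
    (fun n => div_le_div_of_nonneg_right (Nat.cast_le.2 (Nat.count_le_card hfinite n))
      n.cast_nonneg)
    (tendsto_const_div_atTop_nhds_zero_nat _)

lemma tendsto_count_atTop {p : ℕ → Prop} [DecidablePred p] (hp : {k | p k}.Infinite) :
    Tendsto (Nat.count p) atTop atTop :=
  tendsto_atTop_atTop.2 fun b => ⟨Nat.nth p b, fun _ hn =>
    (Nat.count_nth_of_infinite hp b).symm.le.trans (Nat.count_monotone p hn)⟩

lemma tendsto_sum_ite_div {p : ℕ → Prop} [DecidablePred p] {y : ℕ → ℝ} {r : ℝ} {d : ℝ≥0∞}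
    (hr : 0 < r) (hp : Tendsto (fun n : ℕ => (Nat.count p n : ℝ) / n) atTop (𝓝 r))
    (hy : Tendsto (fun n : ℕ => (((∑ m ∈ Finset.range n, y (Nat.nth p m)) / n : ℝ) : EReal))
      atTop (𝓝 (d : EReal))) :
    Tendsto (fun n : ℕ => (((∑ k ∈ Finset.range n, if p k then y k else 0) / n : ℝ) : EReal))
      atTop (𝓝 ((ENNReal.ofReal r * d : ℝ≥0∞) : EReal)) := by
  refine (tendsto_coe_mul hr hp
    (hy.comp (tendsto_count_atTop (infinite_of_tendsto_count_div hr.ne' hp)))).congr fun n => ?_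
  rw [sum_range_ite_eq_sum_range_count]
  rcases eq_or_ne (Nat.count p n) 0 with h | h
  · simp [h]
  · rw [div_mul_div_comm, mul_comm (n : ℝ), mul_div_mul_left _ _ (Nat.cast_ne_zero.2 h)]

end Limits

namespace SensorNetwork

section FreshPackets

variable {L : ℕ} {E : Type*} [MeasurableSpace E] (N : SensorNetwork L E)

/-- In slot `k + 1` a packet of sensor `i` sampled after slot `ν` is received. -/
def FreshFrom (ν : ℤ) (s : Fin L → Finset ℤ) (w : ℕ → SlotNoise L) (i : Fin L) (k : ℕ) : Prop :=
  delivered (w k) (fun j => (N.queuePath s w k j).card) = some i ∧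
    ν < N.discipline i (N.queuePath s w k i)

instance (ν : ℤ) (s : Fin L → Finset ℤ) (w : ℕ → SlotNoise L) (i : Fin L) :
    DecidablePred (N.FreshFrom ν s w i) := fun k => by
  unfold FreshFrom; infer_instance

/-- The slots with a sample of sensor `i`, and the slots in which the channel would deliver a
packet, have the long-run frequencies predicted by their probabilities. -/
def HasExpectedFrequencies (w : ℕ → SlotNoise L) : Prop :=
  (∀ i, Tendsto (fun n : ℕ => (∑ k ∈ Finset.range n, if (w k).1 i then (1 : ℝ) else 0) / n) atTop
    (𝓝 (N.rate i))) ∧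
  Tendsto (fun n : ℕ => (∑ k ∈ Finset.range n, if (w k).2.1 then (1 : ℝ) else 0) / n) atTop
    (𝓝 N.success)

variable {N} {ν : ℤ} {s : Fin L → Finset ℤ} {w : ℕ → SlotNoise L}

lemma packet_eq_some_of_freshFrom {i : Fin L} {k : ℕ} (h : N.FreshFrom ν s w i k) :
    N.packet s w k = some (N.discipline i (N.queuePath s w k i), i) :=
  packet_eq_some_iff.2 ⟨h.1, rfl⟩

lemma sum_queuePath_succ {M : Type*} [AddCommMonoid M] (hs : ∀ i, ∀ t ∈ s i, t ≤ 0) (k : ℕ)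
    (i : Fin L) (f : ℤ → M) :
    ∑ t ∈ N.queuePath s w (k + 1) i, f t +
        (if delivered (w k) (fun j => (N.queuePath s w k j).card) = some i then
          f (N.discipline i (N.queuePath s w k i)) else 0) =
      ∑ t ∈ N.queuePath s w k i, f t + if (w k).1 i then f ((k : ℤ) + 1) else 0 := by
  set Q := N.queuePath s w k i
  set A := if delivered (w k) (fun j => (N.queuePath s w k j).card) = some i
    then Q.erase (N.discipline i Q) else Q with hA
  have hnew : (k : ℤ) + 1 ∉ Q := fun h => by
    have := le_of_mem_queuePath (x := ((k : ℤ) + 1, i)) hs h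
    simp at this
  have hAQ : A ⊆ Q := by
    rw [hA]; split_ifs
    exacts [Finset.erase_subset _ _, subset_rfl]
  have hdeparture : ∑ t ∈ A, f t +
      (if delivered (w k) (fun j => (N.queuePath s w k j).card) = some i then
        f (N.discipline i Q) else 0) = ∑ t ∈ Q, f t := by
    rw [hA]
    split_ifs with h
    · exact Finset.sum_erase_add _ _ (mem_queuePath_of_packet_eq_some
        (x := (N.discipline i Q, i)) (packet_eq_some_iff.2 ⟨h, rfl⟩))
    · exact add_zero _
  have harrival : ∑ t ∈ N.queuePath s w (k + 1) i, f t =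
      ∑ t ∈ A, f t + if (w k).1 i then f ((k : ℤ) + 1) else 0 := by
    change ∑ t ∈ A ∪ (if (w k).1 i then {(k : ℤ) + 1} else ∅), f t = _
    split_ifs
    · rw [Finset.sum_union (Finset.disjoint_singleton_right.2 fun h => hnew (hAQ h)),
        Finset.sum_singleton]
    · simp
  rw [harrival, add_right_comm, hdeparture]

lemma card_queuePath_succ (hs : ∀ i, ∀ t ∈ s i, t ≤ 0) (k : ℕ) (i : Fin L) :
    (N.queuePath s w (k + 1) i).card =
      lengthStep (w k) (fun j => (N.queuePath s w k j).card) i := by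
  have hcard := sum_queuePath_succ (N := N) (w := w) hs k i fun _ => 1
  simp only [← Finset.card_eq_sum_ones] at hcard
  exact Nat.add_right_cancel
    (hcard.trans (lengthStep_add (w k) (fun j => (N.queuePath s w k j).card) i).symm)

lemma sum_queuePath_add_sum_delivered {M : Type*} [AddCommMonoid M]
    (hs : ∀ i, ∀ t ∈ s i, t ≤ 0) (n : ℕ) (i : Fin L) (f : ℤ → M) :
    ∑ t ∈ N.queuePath s w n i, f t + ∑ k ∈ Finset.range n,
        (if delivered (w k) (fun j => (N.queuePath s w k j).card) = some i then
          f (N.discipline i (N.queuePath s w k i)) else 0) =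
      ∑ t ∈ s i, f t + ∑ k ∈ Finset.range n, if (w k).1 i then f ((k : ℤ) + 1) else 0 := by
  induction n with
  | zero => rfl
  | succ n ih =>
    rw [Finset.sum_range_succ, Finset.sum_range_succ, ← add_assoc (∑ t ∈ s i, f t), ← ih,
      add_right_comm, ← sum_queuePath_succ hs]
    abel

lemma ae_tendsto_frequency (N : SensorNetwork L E) (A : Set (SlotNoise L))
    [DecidablePred (· ∈ A)] :
    ∀ᵐ w ∂Measure.infinitePi (fun _ : ℕ => N.slotLaw),
      Tendsto (fun n : ℕ => (∑ k ∈ Finset.range n, if w k ∈ A then (1 : ℝ) else 0) / n) atTop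
        (𝓝 (N.slotLaw.real A)) := by
  have hlim := ae_tendsto_average_of_integrable (f := A.indicator 1)
    (fun k => (measurePreserving_eval_infinitePi (fun _ : ℕ => N.slotLaw) k).hasLaw)
    (fun k m hkm => indepFun_eval_infinitePi (fun _ : ℕ => N.slotLaw) hkm) .of_discrete
    ((integrable_const (1 : ℝ)).indicator .of_discrete)
  rw [integral_indicator_one .of_discrete] at hlim
  filter_upwards [hlim] with w hw
  simpa [Set.indicator_apply] using hw

lemma ae_hasExpectedFrequencies (N : SensorNetwork L E) :
    ∀ᵐ w ∂Measure.infinitePi (fun _ : ℕ => N.slotLaw), N.HasExpectedFrequencies w := by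
  refine (ae_all_iff.2 fun i => ?_).and ?_
  · rw [← slotLaw_real_sampled]
    exact N.ae_tendsto_frequency {w | w.1 i = true}
  · rw [← slotLaw_real_success]
    exact N.ae_tendsto_frequency {w | w.2.1 = true}

section

variable (hs : ∀ i, ∀ t ∈ s i, t ≤ 0) (hw : N.HasExpectedFrequencies w)
  (hload : ∑ i, (N.rate i : ℝ) ≤ N.success)

include hs

lemma sum_card_queuePath_succ (n : ℕ) :
    ∑ i, (N.queuePath s w (n + 1) i).card ≤ L ∨
      ∑ i, (N.queuePath s w (n + 1) i).card + (if (w n).2.1 then 1 else 0) =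
        ∑ i, (N.queuePath s w n i).card + ∑ i, if (w n).1 i then 1 else 0 := by
  simp only [card_queuePath_succ hs]
  rcases eq_or_ne (fun j => (N.queuePath s w n j).card) 0 with hempty | hne
  · left
    rw [hempty]
    refine (Finset.sum_le_card_nsmul Finset.univ _ 1 fun i _ => ?_).trans (by simp)
    simp only [lengthStep, Pi.zero_apply, Nat.zero_sub, zero_add]
    split_ifs <;> norm_num
  · exact .inr (sum_lengthStep_add (w n) hne)

include hw hload

lemma tendsto_sum_card_queuePath_div :
    Tendsto (fun n : ℕ => ((∑ i, (N.queuePath s w n i).card : ℕ) : ℝ) / n) atTop (𝓝 0) := by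
  refine tendsto_div_zero_of_le_or_step_le (C := L) (sub_nonpos.2 hload)
    (fun n => Nat.cast_nonneg _)
    (x := fun k => (∑ i, if (w k).1 i then (1 : ℝ) else 0) - if (w k).2.1 then 1 else 0)
    (fun n => ?_) ?_
  · refine (sum_card_queuePath_succ (N := N) (w := w) hs n).imp
      (fun h => Nat.cast_le.2 h) fun h => ?_
    have hreal := congrArg (Nat.cast (R := ℝ)) h
    push_cast at hreal ⊢
    linarith
  · refine ((tendsto_finsetSum Finset.univ fun i _ => hw.1 i).sub hw.2).congr fun n => ?_
    rw [← Finset.sum_div, Finset.sum_comm, ← sub_div, ← Finset.sum_sub_distrib]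

lemma tendsto_sum_queuePath_div (i : Fin L) {f : ℤ → ℝ} (hf : ∀ t, f t ∈ Set.Icc 0 1) :
    Tendsto (fun n : ℕ => (∑ t ∈ N.queuePath s w n i, f t) / n) atTop (𝓝 0) := by
  refine squeeze_zero
    (fun n => div_nonneg (Finset.sum_nonneg fun t _ => (hf t).1) n.cast_nonneg) (fun n => ?_)
    (tendsto_sum_card_queuePath_div hs hw hload)
  refine div_le_div_of_nonneg_right ?_ n.cast_nonneg
  calc ∑ t ∈ N.queuePath s w n i, f t
      ≤ (N.queuePath s w n i).card := by
        simpa using Finset.sum_le_card_nsmul _ f 1 fun t _ => (hf t).2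
    _ ≤ (∑ i, (N.queuePath s w n i).card : ℕ) := Nat.cast_le.2 <|
        Finset.single_le_sum (f := fun i => (N.queuePath s w n i).card)
          (fun _ _ => Nat.zero_le _) (Finset.mem_univ i)

lemma tendsto_count_freshFrom_div (i : Fin L) :
    Tendsto (fun n : ℕ => (Nat.count (N.FreshFrom ν s w i) n : ℝ) / n) atTop (𝓝 (N.rate i)) := by
  set f : ℤ → ℝ := fun t => if ν < t then 1 else 0
  have hf : ∀ t, f t ∈ Set.Icc 0 1 := fun t => by
    simp only [f]; split_ifs <;> simp
  have hcount (n : ℕ) : (Nat.count (N.FreshFrom ν s w i) n : ℝ) = ∑ k ∈ Finset.range n,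
      if delivered (w k) (fun j => (N.queuePath s w k j).card) = some i then
        f (N.discipline i (N.queuePath s w k i)) else 0 := by
    simp only [f, ← ite_and]
    exact Eq.symm <| (sum_range_ite_eq_sum_range_count (N.FreshFrom ν s w i)
      (fun _ => (1 : ℝ)) n).trans (by simp)
  have hsampled : Tendsto (fun n : ℕ =>
      (∑ k ∈ Finset.range n, if (w k).1 i then f ((k : ℤ) + 1) else 0) / n) atTop
      (𝓝 (N.rate i)) := by
    refine tendsto_average_congr ?_ (hw.1 i)
    filter_upwards [eventually_ge_atTop ν.toNat] with k hk
    rw [show f ((k : ℤ) + 1) = 1 from if_pos (by omega)]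
  have hinitial := tendsto_const_div_atTop_nhds_zero_nat (∑ t ∈ s i, f t)
  have hwaiting := tendsto_sum_queuePath_div hs hw hload i hf
  have hlim := (hinitial.add hsampled).sub hwaiting
  rw [zero_add, sub_zero] at hlim
  refine hlim.congr fun n => ?_
  rw [← add_div, ← sub_div, hcount, ← sum_queuePath_add_sum_delivered (N := N) hs,
    add_sub_cancel_left]

end

end FreshPackets

section Rate

variable {L : ℕ} {E : Type*} [MeasurableSpace E] {N : SensorNetwork L E} {ν : ℤ}

lemma log_slotLR_obsAt {s : Fin L → Finset ℤ} {w : ℕ → SlotNoise L} {X : ℤ × Fin L → E}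
    (hX : ∀ x : ℤ × Fin L, x.1 ≤ ν → N.sampleLR ν x (X x) = 1) (k : ℕ) :
    Real.log (N.slotLR ν (N.obsAt (s, w, X) k)).toReal =
      ∑ i, if N.FreshFrom ν s w i k then
        llr (N.post i : Measure E) (N.pre i) (X (N.discipline i (N.queuePath s w k i), i))
        else 0 := by
  rw [slotLR_obsAt]
  cases hpacket : N.packet s w k with
  | none =>
    have hnone : ∀ i, ¬ N.FreshFrom ν s w i k := fun i hi => by
      simpa [hpacket] using packet_eq_some_of_freshFrom hi
    simp [hnone]
  | some x =>
    obtain ⟨hdelivered, hslot⟩ := packet_eq_some_iff.1 hpacket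
    rw [Option.toFinset_some, Finset.prod_singleton, Finset.sum_eq_single x.2]
    · simp only [FreshFrom, hdelivered, hslot, true_and]
      split_ifs with hx
      · have htop : (x.1 : WithTop ℤ) ≤ ⊤ := le_top
        rw [sampleLR, sampleLaw_of_lt (WithTop.coe_lt_coe.2 hx), sampleLaw_of_le htop, llr]
      · simp [hX x (not_lt.1 hx)]
    · exact fun i _ hi => if_neg fun h => hi (Option.some.inj (h.1.symm.trans hdelivered))
    · exact fun h => absurd (Finset.mem_univ _) h

lemma ae_sampleLR_eq_one (N : SensorNetwork L E) (ν : ℤ) :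
    ∀ᵐ X ∂Measure.infinitePi (N.sampleLaw ν),
      ∀ x : ℤ × Fin L, x.1 ≤ ν → N.sampleLR ν x (X x) = 1 := by
  refine ae_all_iff.2 fun x => ?_
  by_cases hx : x.1 ≤ ν
  · have hself : N.sampleLR ν x =ᵐ[N.sampleLaw ν x] 1 := by
      have htop : (x.1 : WithTop ℤ) ≤ ⊤ := le_top
      rw [sampleLR, sampleLaw_of_le (WithTop.coe_le_coe.2 hx), sampleLaw_of_le htop]
      exact Measure.rnDeriv_self _
    filter_upwards [(measurePreserving_eval_infinitePi (N.sampleLaw ν)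
      x).quasiMeasurePreserving.ae hself] with X hX _ using hX
  · exact ae_of_all _ fun X h => absurd h hx

lemma ae_tendsto_average_llr_freshFrom (hac : ∀ i, (N.post i : Measure E) ≪ N.pre i)
    {s : Fin L → Finset ℤ} (hs : ∀ i, ∀ t ∈ s i, t ≤ 0) {w : ℕ → SlotNoise L} {i : Fin L}
    (hfresh : {k | N.FreshFrom ν s w i k}.Infinite) :
    ∀ᵐ X ∂Measure.infinitePi (N.sampleLaw ν), Tendsto (fun n : ℕ =>
        (((∑ m ∈ Finset.range n, llr (N.post i : Measure E) (N.pre i)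
          (X (N.discipline i (N.queuePath s w (Nat.nth (N.FreshFrom ν s w i) m) i), i))) / n
            : ℝ) : EReal)) atTop
      (𝓝 (klDiv (N.post i : Measure E) (N.pre i : Measure E) : EReal)) := by
  set σ : ℕ → ℤ × Fin L := fun m =>
    (N.discipline i (N.queuePath s w (Nat.nth (N.FreshFrom ν s w i) m) i), i)
  have hnth (m : ℕ) : N.FreshFrom ν s w i (Nat.nth (N.FreshFrom ν s w i) m) :=
    Nat.nth_mem_of_infinite hfresh m
  have hσ : σ.Injective := fun m m' h => Nat.nth_injective hfresh <|
    eq_of_packet_eq_some hs (packet_eq_some_of_freshFrom (hnth m))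
      ((packet_eq_some_of_freshFrom (hnth m')).trans (congrArg some h.symm))
  have hpost (m : ℕ) : N.sampleLaw ν (σ m) = N.post i :=
    sampleLaw_of_lt (WithTop.coe_lt_coe.2 (hnth m).2)
  exact ae_tendsto_average_llr
    (fun m => hpost m ▸ (measurePreserving_eval_infinitePi (N.sampleLaw ν) (σ m)).hasLaw)
    (fun m m' h => indepFun_eval_infinitePi (N.sampleLaw ν) (hσ.ne h)) (hac i)

variable (hrate : ∀ i, 0 < (N.rate i : ℝ)) (hload : ∑ i, (N.rate i : ℝ) ≤ N.success)
  (hac : ∀ i, (N.post i : Measure E) ≪ (N.pre i : Measure E))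

include hrate hload hac

lemma ae_infinitePi_tendsto_sum_log_slotLR_div {s : Fin L → Finset ℤ}
    (hs : ∀ i, ∀ t ∈ s i, t ≤ 0) {w : ℕ → SlotNoise L} (hw : N.HasExpectedFrequencies w) :
    ∀ᵐ X ∂Measure.infinitePi (N.sampleLaw ν), Tendsto (fun n : ℕ =>
        (((∑ k ∈ Finset.range n, Real.log (N.slotLR ν (N.obsAt (s, w, X) k)).toReal) / n
          : ℝ) : EReal)) atTop
      (𝓝 ((∑ i, ENNReal.ofReal (N.rate i) *
        klDiv (N.post i : Measure E) (N.pre i : Measure E) : ℝ≥0∞) : EReal)) := by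
  have hcount := tendsto_count_freshFrom_div (ν := ν) hs hw hload
  have hinfinite := fun i => infinite_of_tendsto_count_div (hrate i).ne' (hcount i)
  filter_upwards [ae_sampleLR_eq_one N ν, ae_all_iff.2 fun i =>
    ae_tendsto_average_llr_freshFrom hac hs (hinfinite i)] with X hstale hfresh
  have hlim := tendsto_coe_finsetSum Finset.univ fun i _ =>
    tendsto_sum_ite_div (y := fun k => llr (N.post i : Measure E) (N.pre i)
      (X (N.discipline i (N.queuePath s w k i), i))) (hrate i) (hcount i) (hfresh i)
  simp only [← Finset.sum_div] at hlim
  simp only [log_slotLR_obsAt hstale]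
  simpa only [Finset.sum_comm (s := Finset.range _)] using hlim

lemma ae_law_tendsto_sum_log_slotLR_div {init : PMF (Fin L → Finset ℤ)}
    (hinit : ∀ s ∈ init.support, ∀ i, ∀ t ∈ s i, t ≤ 0) :
    ∀ᵐ ω ∂N.law init ν, Tendsto (fun n : ℕ =>
        (((∑ k ∈ Finset.range n, Real.log (N.slotLR ν (N.obsAt ω k)).toReal) / n
          : ℝ) : EReal)) atTop
      (𝓝 ((∑ i, ENNReal.ofReal (N.rate i) *
        klDiv (N.post i : Measure E) (N.pre i : Measure E) : ℝ≥0∞) : EReal)) := by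
  have hmeas := measurableSet_tendsto
    (𝓝 ((∑ i, ENNReal.ofReal (N.rate i) *
      klDiv (N.post i : Measure E) (N.pre i : Measure E) : ℝ≥0∞) : EReal)) (l := atTop)
    (f := fun (n : ℕ) (ω : Outcome L E) =>
      (((∑ k ∈ Finset.range n, Real.log (N.slotLR ν (N.obsAt ω k)).toReal) / n : ℝ) : EReal))
    fun n => measurable_coe_real_ereal.comp <| (Finset.measurable_sum _ fun k _ =>
      (measurable_slotLR.comp (N.measurable_obsAt k)).ennreal_toReal.log).div_const _
  rw [law, Measure.ae_prod_iff_ae_ae hmeas]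
  filter_upwards [ae_toMeasure_mem_support init] with s hs
  refine (Measure.ae_prod_iff_ae_ae (measurable_prodMk_left (x := s) hmeas)).2 ?_
  filter_upwards [N.ae_hasExpectedFrequencies] with w hw
  exact ae_infinitePi_tendsto_sum_log_slotLR_div hrate hload hac (hinit s hs) hw

end Rate

end SensorNetwork

theorem mainTheorem7_general {L : ℕ} {E : Type*} [MeasurableSpace E] (N : SensorNetwork L E)
    (hrate : ∀ i, 0 < (N.rate i : ℝ))
    (hload : ∑ i, (N.rate i : ℝ) ≤ (N.success : ℝ))
    (hac : ∀ i, (N.post i : Measure E) ≪ (N.pre i : Measure E)) :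
    (∑ i, (N.rate i : ℝ) < (N.success : ℝ) →
      ∃! π : Measure (Fin L → ℕ), N.IsStationary π) ∧
    (∀ π : Measure (Fin L → ℕ), N.IsStationary π →
      (π.prod N.slotLaw).real (SensorNetwork.received L) = ∑ i, (N.rate i : ℝ) ∧
      ∀ i, ((π.prod N.slotLaw)[|SensorNetwork.received L]).real (SensorNetwork.receivedFrom i) =
        (N.rate i : ℝ) / ∑ j, (N.rate j : ℝ)) ∧
    (∀ (ν : ℤ) (init : PMF (Fin L → Finset ℤ)),
      (∀ s ∈ init.support, ∀ i, ∀ t ∈ s i, t ≤ 0) →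
      (∀ n, N.obsLaw init ν n ≪ N.obsLaw init ⊤ n) ∧
      ∀ᵐ ω ∂(N.law init ν),
        Tendsto (fun n : ℕ => ((N.logLR init ν n ω / n : ℝ) : EReal)) atTop
          (𝓝 ((∑ i, ENNReal.ofReal (N.rate i) *
            klDiv (N.post i : Measure E) (N.pre i : Measure E) : ℝ≥0∞) : EReal))) := by
  refine ⟨N.existsUnique_isStationary, fun π hπ =>
    ⟨SensorNetwork.measureReal_received hπ, SensorNetwork.cond_received_receivedFrom hπ⟩,
    fun ν init hinit => ⟨fun n => ?_, ?_⟩⟩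
  · rw [SensorNetwork.obsLaw_eq_withDensity hac hinit n]
    exact withDensity_absolutelyContinuous _ _
  · filter_upwards [SensorNetwork.ae_law_tendsto_sum_log_slotLR_div hrate hload hac hinit,
      ae_all_iff.2 (SensorNetwork.logLR_ae_eq_sum hac hinit)] with ω hlim hlogLR
    simpa only [hlogLR] using hlim

theorem mainTheorem7 {L : ℕ} {E : Type*} [MeasurableSpace E] (N : SensorNetwork L E)
    (hrate : ∀ i, 0 < (N.rate i : ℝ))
    (hstable : ∑ i, (N.rate i : ℝ) < (N.success : ℝ))
    (hac : ∀ i, (N.post i : Measure E) ≪ (N.pre i : Measure E)) :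
    (∃! π : Measure (Fin L → ℕ), N.IsStationary π) ∧
    (∀ π : Measure (Fin L → ℕ), N.IsStationary π →
      (π.prod N.slotLaw).real (SensorNetwork.received L) = ∑ i, (N.rate i : ℝ) ∧
      ∀ i, ((π.prod N.slotLaw)[|SensorNetwork.received L]).real (SensorNetwork.receivedFrom i) =
        (N.rate i : ℝ) / ∑ j, (N.rate j : ℝ)) ∧
    (∀ (q : Fin L → ℕ) (init : PMF (Fin L → Finset ℤ)),
      (∀ s ∈ init.support, ∀ i, (s i).card = q i ∧ ∀ t ∈ s i, t ≤ 0) →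
      (∀ n, N.obsLaw init 0 n ≪ N.obsLaw init ⊤ n) ∧
      ∀ᵐ ω ∂(N.law init 0),
        Tendsto (fun n : ℕ => ((N.logLR init 0 n ω / n : ℝ) : EReal)) atTop
          (𝓝 ((∑ i, ENNReal.ofReal (N.rate i) *
            klDiv (N.post i : Measure E) (N.pre i : Measure E) : ℝ≥0∞) : EReal))) := by
  obtain ⟨hunique, hstationary, hrateLimit⟩ := mainTheorem7_general N hrate hstable.le hac
  exact ⟨hunique hstable, hstationary, fun _ init hinit =>
    hrateLimit 0 init fun s hs i => (hinit s hs i).2⟩
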